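/- Let $(\Omega,\{\Omega_n\},\rho,\mu)$ be a locally homogeneous space: $\rho:\Omega\times\Omega\to[0,\infty)$ is symmetric and vanishes exactly on the diagonal; $\Omega$ carries the topology in which $A$ is open iff each $x\in A$ has a ball $B(x,r)=\{y:\rho(x,y)<r\}\subset A$; balls are open and $\overline{B(x,r)}\subset\{y:\rho(x,y)\le r\}$; $\mu$ is a positive regular Borel measure; $\Omega_n$ is an increasing sequence of bounded measurable sets with compact closures and union $\Omega$; and there are constants $\varepsilon_n>0$, $B_n\ge1$, $C_n>1$ with $\{x:\rho(x,y)<2\varepsilon_n\text{ for some }y\in\Omega_n\}\subset\Omega_{n+1}$, with $\rho(x,y)\le B_n(\rho(x,z)+\rho(z,y))$ for $x,y,z\in\Omega_n$, and with $0<\mu(B(x,2r))\le C_n\mu(B(x,r))<\infty$ for $x\in\Omega_n$, $0<r\le\varepsilon_n$. **BMO and VMO.** Put $\mathrm{osc}(u,A)=\frac1{\mu(A)}\int_A|u-u_A|\,d\mu$, where $u_A$ is the mean of $u$ on $A$. For real $u\in L^1(\Omega_{n+1})$ and $0<r\le\varepsilon_n$ let $\eta^*_{u,\Omega_n,\Omega_{n+1}}(r)=\sup_{t\le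 r}\sup_{x\in\Omega_n}\mathrm{osc}(u,B(x,t))$ and $\|u\|_{BMO_{loc}(\Omega_n,\Omega_{n+1})}=\sup_{r\le\varepsilon_n}\eta^*_{u,\Omega_n,\Omega_{n+1}}(r)$. Then $u\in BMO_{loc}(\Omega_n,\Omega_{n+1})$ if this is finite, and $u\in VMO_{loc}(\Omega_n,\Omega_{n+1})$ if moreover $\eta^*_{u,\Omega_n,\Omega_{n+1}}(r)\to0$ as $r\to0$. If $S\subset\Omega$ is a space of homogeneous type with respect to $\rho,\mu$, then $\|u\|_{BMO(S)}=\sup_{t>0}\sup_{x\in S}\mathrm{osc}(u,B(x,t)\cap S)$, and $u\in BMO(S)$ if $u\in L^1(S)$ and this is finite. **Dyadic cubes.** For $m\ge1$ and $0<\delta<1$, a dyadic system for $\Omega_m$ with parameter $\delta$ consists of points $z^k_\alpha$ ($k=1,2,\dots$, $\alpha\in I_k$) and a tree. The points $\{z^1_\alpha\}$ form a maximal subset of $\Omega_m$ whose distinct points are at mutual distance $\ge\delta$, and $\{z_\alpha^{k+1}\}$ is a maximal subset of $\bigcup_\beta B(z^k_\beta,\delta^k)$ whose distinct points are at mutual distance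 $\ge\delta^{k+1}$. The tree is a partial order on the pairs $(k,\alpha)$ such that: $(k,\alpha)\le(l,\beta)$ implies $k\ge l$; for each $(k,\alpha)$ and $1\le l\le k$ there is a unique $\beta$ with $(k,\alpha)\le(l,\beta)$; $(k+1,\alpha)\le(k,\beta)$ implies $\rho(z^{k+1}_\alpha,z^k_\beta)<\delta^k$; and $\rho(z^{k+1}_\alpha,z^k_\beta)<(2B_{m+1})^{-1}\delta^k$ implies $(k+1,\alpha)\le(k,\beta)$. The cubes are $Q^k_\alpha=\bigcup_{(l,\beta)\le(k,\alpha)}B(z^l_\beta,\delta^{l+1})$. **The set $F$.** Let $\overline x\in\Omega_n$ and $\delta^{k+1}<R\le\delta^k$ with $k\ge1$. Put $c_1=7B_{n+1}^4$ and $h=B_{n+1}(1+c_1)$. Let $F$ be the union of all cubes of generation $k$, of a dyadic system for $\Omega_{n+1}$ with parameter $\delta$, that intersect $B(z,h\delta^k)$, where $z\in\Omega_{n+1}$ is a point with $\rho(\overline x,z)<c_1\delta^k$ (for instance the centre $z^k_\alpha$ of a cube of generation $k$ for $\Omega_n$ containing $\overline x$). We call such an $F$ a *dyadic set for* $B(\overline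 x,R)$. **Proposition.** There is $\delta_0>0$, depending only on the constants $\varepsilon_i,B_i,C_i$ with $i=n,\dots,n+3$, such that for every $\delta\in(0,\delta_0]$ there are $c,R_n>0$, depending only on these constants and on $\delta$, with $cR_n\le\varepsilon_{n+2}$ and the following properties. For every $\overline x\in\Omega_n$ and $0<R\le R_n$ dyadic sets for $B(\overline x,R)$ exist, and every such set $F$ satisfies: 1. $F$ is open and is a space of homogeneous type with quasitriangle and doubling constant $c$; $B(\overline x,R)\setminus E\subset F\subset\Omega_{n+2}$ for some $E$ with $\mu(E)=0$; $B(\overline x,R)\subset\overline F$; $\mathrm{diam}\,F\le cR$; and $\mu(F)\le c\,\mu(B(\overline x,R))$. 2. If $f\in BMO_{loc}(\Omega_{n+2},\Omega_{n+3})$, then $f\in BMO(F)$ and $$\|f\|_{BMO(F)}\le c\,\eta^*_{f,\Omega_{n+2},\Omega_{n+3}}(cR)\le c\,\|f\|_{BMO_{loc}(\Omega_{n+2},\Omega_{n+3})}.$$ In particular, if $f\in VMO_{loc}(\Omega_{n+2},\Omega_{n+3})$, then for every $\tau>0$ there is $r_0\in(0,R_n]$ such that $\|f\|_{BMO(F)}<\tau$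 for all $\overline x\in\Omega_n$, all $0<R\le r_0$ and all dyadic sets $F$ for $B(\overline x,R)$. -/

import Mathlib

open MeasureTheory Set Filter Topology
open scoped ENNReal

/-- The ball `B(x, r) = {y : ρ(x, y) < r}` of a function `ρ : Ω × Ω → ℝ`. -/
def rhoBall {Ω : Type*} (ρ : Ω → Ω → ℝ) (x : Ω) (r : ℝ) : Set Ω := {y | ρ x y < r}

/-- Locally homogeneous space `(Ω, {Ω_n}, ρ, μ)` with constants `ε_n, B_n, C_n`: the axioms
(H1) to (H6). The domain `Ω_n` is written `D n`. The index starts at `0`, which is only a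
relabelling of a sequence that starts at `1`.
No monotonicity of the sequences of constants is required. -/
structure IsLocallyHomogeneousSpace {Ω : Type*} [TopologicalSpace Ω] [MeasurableSpace Ω]
    [BorelSpace Ω] (ρ : Ω → Ω → ℝ) (μ : Measure Ω) (D : ℕ → Set Ω) (ε B C : ℕ → ℝ) : Prop where
  /-- (H1) -/
  nonneg : ∀ x y, 0 ≤ ρ x y
  eq_zero_iff : ∀ x y, ρ x y = 0 ↔ x = y
  symm : ∀ x y, ρ x y = ρ y x
  /-- the topology (and, by `BorelSpace`, the σ-algebra) is the one given by the balls -/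
  isOpen_iff : ∀ A : Set Ω, IsOpen A ↔ ∀ x ∈ A, ∃ r > 0, rhoBall ρ x r ⊆ A
  /-- (H2) -/
  isOpen_ball : ∀ x r, 0 < r → IsOpen (rhoBall ρ x r)
  closure_ball : ∀ x r, 0 < r → closure (rhoBall ρ x r) ⊆ {y | ρ x y ≤ r}
  /-- (H3) -/
  regular : μ.Regular
  /-- (H4) -/
  mono : Monotone D
  measurableSet : ∀ n, MeasurableSet (D n)
  bounded : ∀ n, ∃ x r, 0 < r ∧ D n ⊆ rhoBall ρ x r
  iUnion_eq : ⋃ n, D n = univ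
  isCompact_closure : ∀ n, IsCompact (closure (D n))
  eps_pos : ∀ n, 0 < ε n
  enlarge : ∀ n, {x | ∃ y ∈ D n, ρ x y < 2 * ε n} ⊆ D (n + 1)
  /-- (H5) -/
  one_le_B : ∀ n, 1 ≤ B n
  quasi_triangle : ∀ n, ∀ x ∈ D n, ∀ y ∈ D n, ∀ z ∈ D n, ρ x y ≤ B n * (ρ x z + ρ z y)
  /-- (H6) -/
  one_lt_C : ∀ n, 1 < C n
  doubling : ∀ n, ∀ x ∈ D n, ∀ r, 0 < r → r ≤ ε n →
    0 < μ (rhoBall ρ x (2 * r)) ∧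
    μ (rhoBall ρ x (2 * r)) ≤ ENNReal.ofReal (C n) * μ (rhoBall ρ x r) ∧
    μ (rhoBall ρ x r) < ∞

/-- The subset `S` of `Ω`, with the restrictions of `ρ` and `μ`, is a space of homogeneous type
in the sense of Coifman and Weiss, with quasitriangle constant `b` and doubling constant `A`. -/
structure IsHomogeneousTypeOn {Ω : Type*} [MeasurableSpace Ω] (ρ : Ω → Ω → ℝ) (μ : Measure Ω)
    (S : Set Ω) (b A : ℝ) : Prop where
  measurableSet : MeasurableSet S
  nonneg : ∀ x ∈ S, ∀ y ∈ S, 0 ≤ ρ x y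
  eq_zero_iff : ∀ x ∈ S, ∀ y ∈ S, (ρ x y = 0 ↔ x = y)
  symm : ∀ x ∈ S, ∀ y ∈ S, ρ x y = ρ y x
  one_le : 1 ≤ b
  quasi_triangle : ∀ x ∈ S, ∀ y ∈ S, ∀ z ∈ S, ρ x y ≤ b * (ρ x z + ρ z y)
  /-- the balls of `S` are open in the topology that they induce on `S` -/
  isOpen_ball : ∀ x ∈ S, ∀ r, 0 < r → ∀ y ∈ rhoBall ρ x r ∩ S,
    ∃ s > 0, rhoBall ρ y s ∩ S ⊆ rhoBall ρ x r ∩ S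
  doubling : ∀ x ∈ S, ∀ r, 0 < r →
    0 < μ (rhoBall ρ x (2 * r) ∩ S) ∧
    μ (rhoBall ρ x (2 * r) ∩ S) ≤ ENNReal.ofReal A * μ (rhoBall ρ x r ∩ S) ∧
    μ (rhoBall ρ x r ∩ S) < ∞

/-! ### Dyadic cubes and the set `F` -/

/-- `Z` is a maximal subset of `S` whose distinct points have mutual distance at least `s`. -/
def IsMaximalNet {Ω : Type*} (ρ : Ω → Ω → ℝ) (s : ℝ) (S Z : Set Ω) : Prop :=
  Maximal (fun Y : Set Ω => Y ⊆ S ∧ Y.Pairwise fun x y => s ≤ ρ x y) Z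

/-- The data from which the dyadic cubes of sidelength `δ ^ k`, `k = 1, 2, …`, adapted to a set
`S` are built: the points `z_α^k` (for fixed `k` they are distinct, so they serve as their own
indices `α`) and a tree, that is a partial ordering of the pairs `(k, α)`.
`le l w k z` means `(l, w) ≤ (k, z)`. Generation `0` is not used. -/
structure DyadicSystem {Ω : Type*} (ρ : Ω → Ω → ℝ) (S : Set Ω) (b δ : ℝ) where
  net : ℕ → Set Ω
  net_one : IsMaximalNet ρ δ S (net 1)
  net_succ : ∀ k, 1 ≤ k →
    IsMaximalNet ρ (δ ^ (k + 1)) (⋃ z ∈ net k, rhoBall ρ z (δ ^ k)) (net (k + 1))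
  le : ℕ → Ω → ℕ → Ω → Prop
  le_mem : ∀ l w k z, le l w k z → 1 ≤ l ∧ w ∈ net l ∧ 1 ≤ k ∧ z ∈ net k
  le_refl : ∀ k z, 1 ≤ k → z ∈ net k → le k z k z
  le_trans : ∀ l w k z j y, le l w k z → le k z j y → le l w j y
  le_antisymm : ∀ l w k z, le l w k z → le k z l w → l = k ∧ w = z
  /-- (T1) -/
  le_level : ∀ l w k z, le l w k z → k ≤ l
  /-- (T2) -/
  existsUnique_ancestor : ∀ k, ∀ z ∈ net k, ∀ l, 1 ≤ l → l ≤ k → ∃! w, le k z l w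
  /-- (T3) -/
  dist_parent : ∀ k z w, le (k + 1) z k w → ρ z w < δ ^ k
  /-- (T4) -/
  le_of_dist_lt : ∀ k, 1 ≤ k → ∀ z ∈ net (k + 1), ∀ w ∈ net k,
    ρ z w < (2 * b)⁻¹ * δ ^ k → le (k + 1) z k w

namespace DyadicSystem

variable {Ω : Type*} {ρ : Ω → Ω → ℝ} {S : Set Ω} {b δ : ℝ}

/-- The dyadic cube `Q_z^k`: the union of the balls `B(w, a₀ δ^l)` over `(l, w) ≤ (k, z)`,
with `a₀ = δ`. -/
def cube (Q : DyadicSystem ρ S b δ) (k : ℕ) (z : Ω) : Set Ω :=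
  ⋃ (l : ℕ) (w : Ω) (_ : Q.le l w k z), rhoBall ρ w (δ * δ ^ l)

/-- The union of those cubes of generation `k` that intersect the set `A`. -/
def cubesMeeting (Q : DyadicSystem ρ S b δ) (k : ℕ) (A : Set Ω) : Set Ω :=
  ⋃ (w : Ω) (_ : w ∈ Q.net k) (_ : (Q.cube k w ∩ A).Nonempty), Q.cube k w

end DyadicSystem

/-- `F` is a set built from the ball `B(x, R)`, `x ∈ Ω_n`, by means of dyadic cubes with
parameter `δ`: if `δ^(k+1) < R ≤ δ^k`, then `F` is the union of the cubes of generation `k`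
adapted to `Ω_{n+1}` that intersect a ball `B(z, h δ^k) ⊇ B(x, R)`. Here
`c₁ = 7 B_{n+1}^4`, `h = B_{n+1} (1 + c₁)`, and `z` is any point of `Ω_{n+1}` with
`ρ(x, z) < c₁ δ^k`, for instance the centre of a cube of generation `k` adapted to `Ω_n` that
contains `x` in its closure, or `x` itself. -/
def IsDyadicNeighbourhood {Ω : Type*} (ρ : Ω → Ω → ℝ) (D : ℕ → Set Ω) (B : ℕ → ℝ) (n : ℕ)
    (δ : ℝ) (x : Ω) (R : ℝ) (F : Set Ω) : Prop :=
  ∃ (Q : DyadicSystem ρ (D (n + 1)) (B (n + 2)) δ) (k : ℕ) (z : Ω),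
    1 ≤ k ∧ δ ^ (k + 1) < R ∧ R ≤ δ ^ k ∧
    z ∈ D (n + 1) ∧ ρ x z < 7 * B (n + 1) ^ 4 * δ ^ k ∧
    F = Q.cubesMeeting k
      (rhoBall ρ z (B (n + 1) * (1 + 7 * B (n + 1) ^ 4) * δ ^ k))

/-! ### `BMO` and `VMO` -/

section BMO

variable {Ω : Type*} [MeasurableSpace Ω]

/-- The mean oscillation `μ(A)⁻¹ ∫_A |u - u_A| dμ`, with values in `[0, ∞]`. -/
noncomputable def meanOsc (μ : Measure Ω) (u : Ω → ℝ) (A : Set Ω) : ℝ≥0∞ :=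
  (μ A)⁻¹ * ∫⁻ y in A, ‖u y - ⨍ z in A, u z ∂μ‖ₑ ∂μ

/-- The local modulus `η*_{u, Ω_n, Ω_{n+1}}(r)`. -/
noncomputable def locModulus (ρ : Ω → Ω → ℝ) (μ : Measure Ω) (D : ℕ → Set Ω) (n : ℕ)
    (u : Ω → ℝ) (r : ℝ) : ℝ≥0∞ :=
  ⨆ t ∈ Ioc (0 : ℝ) r, ⨆ x ∈ D n, meanOsc μ u (rhoBall ρ x t)

/-- The norm of `BMO_loc(Ω_n, Ω_{n+1})`. -/
noncomputable def bmoLocNorm (ρ : Ω → Ω → ℝ) (μ : Measure Ω) (D : ℕ → Set Ω) (ε : ℕ → ℝ) (n : ℕ)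
    (u : Ω → ℝ) : ℝ≥0∞ :=
  ⨆ r ∈ Ioc (0 : ℝ) (ε n), locModulus ρ μ D n u r

/-- `u ∈ BMO_loc(Ω_n, Ω_{n+1})`; only the values of `u` on `Ω_{n+1}` matter. -/
def MemBMOloc (ρ : Ω → Ω → ℝ) (μ : Measure Ω) (D : ℕ → Set Ω) (ε : ℕ → ℝ) (n : ℕ)
    (u : Ω → ℝ) : Prop :=
  IntegrableOn u (D (n + 1)) μ ∧ bmoLocNorm ρ μ D ε n u < ∞

/-- `u ∈ VMO_loc(Ω_n, Ω_{n+1})`. -/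
def MemVMOloc (ρ : Ω → Ω → ℝ) (μ : Measure Ω) (D : ℕ → Set Ω) (ε : ℕ → ℝ) (n : ℕ)
    (u : Ω → ℝ) : Prop :=
  MemBMOloc ρ μ D ε n u ∧ Tendsto (locModulus ρ μ D n u) (𝓝[>] 0) (𝓝 0)

/-- The modulus `η_{u, S}(r)` of a function on a space of homogeneous type `S ⊆ Ω`. -/
noncomputable def modulusOn (ρ : Ω → Ω → ℝ) (μ : Measure Ω) (S : Set Ω) (u : Ω → ℝ) (r : ℝ) :
    ℝ≥0∞ :=
  ⨆ t ∈ Ioc (0 : ℝ) r, ⨆ x ∈ S, meanOsc μ u (rhoBall ρ x t ∩ S)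

/-- The norm of `BMO(S)`. -/
noncomputable def bmoNormOn (ρ : Ω → Ω → ℝ) (μ : Measure Ω) (S : Set Ω) (u : Ω → ℝ) : ℝ≥0∞ :=
  ⨆ r ∈ Ioi (0 : ℝ), modulusOn ρ μ S u r

/-- `u ∈ BMO(S)`. -/
def MemBMOOn (ρ : Ω → Ω → ℝ) (μ : Measure Ω) (S : Set Ω) (u : Ω → ℝ) : Prop :=
  IntegrableOn u S μ ∧ bmoNormOn ρ μ S u < ∞

end BMO

/-! ### Quasi-metric frames and nets -/

/-! A ball need not be a space of homogeneous type, since its intersection with a small ball near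
its boundary may be too thin. A union of dyadic cubes avoids this. The proof works in a frame `S ⊆ Y
⊆ X`, here `Ω_{n+1} ⊆ Ω_{n+2} ⊆ Ω_{n+3}`, with `δ` so small that every net and cube stays in `Y` and
the quasitriangle inequality on `X` applies throughout.

Cubes of one generation are disjoint, and the finer cubes are dense near the nets. Hence each point
`x` of a cube is within a multiple of `δ ^ j` of a descendant `u` of generation `j`
(`exists_le_near`), and the ball of radius `δ ^ (j + 1)` about `u` lies in the cube. With `δ ^ j`
comparable to `r`, or `j = k` for large `r`, this makes `F` plump (`exists_balls`): `B(x, r) ∩ F`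
contains a ball `B(u, s)` of `Ω`, while `B(x, 2r) ∩ F ⊆ B(u, 2 ^ p * s)`.

Plumpness gives both halves. Iterated doubling at `u` makes the measures of these sets comparable,
so `F` is doubling (`IsPlump.doubling`). It also bounds the oscillation on `B(x, r) ∩ F` by a
multiple of that on `B(u, 2 ^ p * s)`, which is controlled by the local modulus of `f`
(`IsPlump.meanOsc_le`). The remaining properties are distance estimates, except that the cubes of
one generation cover almost all of `S`. That follows from a Vitali covering and outer regularity
(`measure_diff_eq_zero`). -/

/-- A symmetric function `ρ` that satisfies a quasitriangle inequality on `X`, together with sets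
`S ⊆ Y ⊆ X` such that neighbourhoods of `S` of size comparable to `δ` lie in `Y`, and
neighbourhoods of `Y` lie in `X`. -/
structure IsQuasiFrame {Ω : Type*} (ρ : Ω → Ω → ℝ) (S Y X : Set Ω) (K δ : ℝ) : Prop where
  nonneg : ∀ x y, 0 ≤ ρ x y
  self : ∀ x, ρ x x = 0
  symm : ∀ x y, ρ x y = ρ y x
  one_le : 1 ≤ K
  tri : ∀ x ∈ X, ∀ y ∈ X, ∀ z ∈ X, ρ x y ≤ K * (ρ x z + ρ z y)
  pos : 0 < δ
  small : 16 * K ^ 3 * δ ≤ 1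
  subY : S ⊆ Y
  subX : Y ⊆ X
  near_S : ∀ x ∈ S, ∀ y, ρ x y ≤ 3 * K ^ 2 * δ → y ∈ Y
  near_Y : ∀ x ∈ Y, ∀ y, ρ x y < δ → y ∈ X

/-- A sequence of maximal nets as in the definition of a dyadic system. -/
structure IsNetSequence {Ω : Type*} (ρ : Ω → Ω → ℝ) (S : Set Ω) (δ : ℝ) (net : ℕ → Set Ω) :
    Prop where
  one : IsMaximalNet ρ δ S (net 1)
  succ : ∀ k, 1 ≤ k →
    IsMaximalNet ρ (δ ^ (k + 1)) (⋃ z ∈ net k, rhoBall ρ z (δ ^ k)) (net (k + 1))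

theorem DyadicSystem.isNetSequence {Ω : Type*} {ρ : Ω → Ω → ℝ} {S : Set Ω} {b δ : ℝ}
    (Q : DyadicSystem ρ S b δ) : IsNetSequence ρ S δ Q.net :=
  ⟨Q.net_one, Q.net_succ⟩

section Frame

variable {Ω : Type*} {ρ : Ω → Ω → ℝ} {S Y X : Set Ω} {K δ : ℝ} {net : ℕ → Set Ω}

theorem IsMaximalNet.exists_near {s : ℝ} {T Z : Set Ω} (h : IsMaximalNet ρ s T Z)
    (hself : ∀ x, ρ x x = 0) (hsymm : ∀ x y, ρ x y = ρ y x) (hs : 0 < s) {x : Ω} (hx : x ∈ T) :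
    ∃ z ∈ Z, ρ z x < s := by
  by_contra! hc
  have hxZ : x ∈ Z := by
    refine h.2 (y := insert x Z) ⟨insert_subset hx h.1.1, ?_⟩ (subset_insert _ _)
      (mem_insert _ _)
    refine h.1.2.insert fun y hy _ => ⟨?_, hc y hy⟩
    rw [hsymm]; exact hc y hy
  have := hc x hxZ
  rw [hself] at this
  linarith

theorem exists_isMaximalNet (ρ : Ω → Ω → ℝ) (s : ℝ) (T : Set Ω) :
    ∃ Z, IsMaximalNet ρ s T Z := by
  refine zorn_subset {Y : Set Ω | Y ⊆ T ∧ Y.Pairwise fun x y => s ≤ ρ x y} fun c hc hchain => ?_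
  refine ⟨⋃₀ c, ⟨sUnion_subset fun t ht => (hc ht).1, ?_⟩, fun t ht => subset_sUnion_of_mem ht⟩
  exact (pairwise_sUnion hchain.directedOn).2 fun t ht => (hc ht).2

theorem exists_isNetSequence (ρ : Ω → Ω → ℝ) (S : Set Ω) (δ : ℝ) :
    ∃ net, IsNetSequence ρ S δ net := by
  choose M hM using exists_isMaximalNet ρ
  let f : ℕ → Set Ω := fun k => Nat.rec (M δ S)
    (fun k Z => M (δ ^ (k + 2)) (⋃ z ∈ Z, rhoBall ρ z (δ ^ (k + 1)))) k
  -- Generations start at 1, so the recursion is shifted; the unused generation 0 repeats generation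
  -- 1.
  refine ⟨fun k => f (k - 1), hM _ _, fun k hk => ?_⟩
  obtain ⟨k, rfl⟩ := Nat.exists_eq_add_of_le' hk
  exact hM _ _

namespace IsQuasiFrame

theorem lt_one (h : IsQuasiFrame ρ S Y X K δ) : δ < 1 := by
  have h1 : 1 ≤ K ^ 3 := one_le_pow₀ h.one_le
  nlinarith [h.small, h.pos]

theorem two_mul_le (h : IsQuasiFrame ρ S Y X K δ) : 2 * K * δ ≤ 1 := by
  have h1 : K ≤ K ^ 3 := le_self_pow₀ h.one_le (by norm_num)
  nlinarith [h.small, h.pos, h.one_le, mul_le_mul_of_nonneg_right h1 h.pos.le]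

theorem pow_pos (h : IsQuasiFrame ρ S Y X K δ) (k : ℕ) : 0 < δ ^ k := _root_.pow_pos h.pos k

theorem pow_anti (h : IsQuasiFrame ρ S Y X K δ) {k l : ℕ} (hkl : k ≤ l) : δ ^ l ≤ δ ^ k :=
  pow_le_pow_of_le_one h.pos.le h.lt_one.le hkl

theorem pow_le (h : IsQuasiFrame ρ S Y X K δ) {k : ℕ} (hk : 1 ≤ k) : δ ^ k ≤ δ := by
  simpa using h.pow_anti hk

/-- The quasitriangle inequality along `x, z, y`, with bounds for both steps. -/
theorem tri_le (h : IsQuasiFrame ρ S Y X K δ) {x y z : Ω} (hx : x ∈ X) (hy : y ∈ X) (hz : z ∈ X)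
    {a b : ℝ} (ha : ρ x z ≤ a) (hb : ρ z y ≤ b) : ρ x y ≤ K * (a + b) :=
  (h.tri x hx y hy z hz).trans
    (mul_le_mul_of_nonneg_left (add_le_add ha hb) (zero_le_one.trans h.one_le))

/-- The coarsest step of the chain is split off: it is shorter than `δ ^ k`, and the rest is at most
`2 * K * δ ^ (k + 1) ≤ δ ^ k`. Each factor `K` is thus absorbed by a factor `δ`, and the bound does
not depend on the length `m`. -/
theorem exists_coarse (h : IsQuasiFrame ρ S Y X K δ) (hN : IsNetSequence ρ S δ net) (m : ℕ) :
    ∀ k, 1 ≤ k → (∀ j, 1 ≤ j → j ≤ k + m → net j ⊆ X) → ∀ w ∈ net (k + m),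
      ∃ z ∈ net k, ρ z w ≤ 2 * K * δ ^ k := by
  induction m with
  | zero =>
    intro k _ _ w hw
    refine ⟨w, hw, ?_⟩
    rw [h.self]
    have := h.pow_pos k
    have := h.one_le
    positivity
  | succ m ih =>
    intro k hk hX w hw
    have e : k + (m + 1) = k + 1 + m := by omega
    obtain ⟨u, hu, hw'⟩ := ih (k + 1) (by omega) (fun j h1 h2 => hX j h1 (by omega)) w (e ▸ hw)
    obtain ⟨z, hz, hzu⟩ := mem_iUnion₂.1 ((hN.succ k hk).1.1 hu)
    refine ⟨z, hz, ?_⟩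
    have := h.tri_le (hX k hk (by omega) hz) (hX _ (by omega) le_rfl hw)
      (hX (k + 1) (by omega) (by omega) hu) (le_of_lt hzu) hw'
    refine this.trans ?_
    have h1 := h.two_mul_le
    have h2 := h.pow_pos k
    have h3 := h.one_le
    rw [pow_succ]
    nlinarith [mul_le_mul_of_nonneg_left h1 (mul_nonneg (zero_le_one.trans h3) h2.le)]

/-- The induction step that keeps all generations in `Y`. The set `X` serves to place `y` where the
quasitriangle inequality holds; the chain back to generation 1 then gives distance at most `K * (2 *
K * δ + δ) ≤ 3 * K ^ 2 * δ` from a point of `S`. -/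
theorem mem_of_near_net (h : IsQuasiFrame ρ S Y X K δ) (hN : IsNetSequence ρ S δ net) {k : ℕ}
    (hk : 1 ≤ k) (hX : ∀ j, 1 ≤ j → j ≤ k → net j ⊆ Y) {z y : Ω} (hz : z ∈ net k)
    (hy : ρ z y < δ ^ k) : y ∈ Y := by
  have hyX : y ∈ X := h.near_Y z (hX k hk le_rfl hz) y (hy.trans_le (h.pow_le hk))
  obtain ⟨m, rfl⟩ := Nat.exists_eq_add_of_le hk
  have hX' : ∀ j, 1 ≤ j → j ≤ 1 + m → net j ⊆ X := fun j h1 h2 => (hX j h1 h2).trans h.subX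
  obtain ⟨z₁, hz₁, h1⟩ := h.exists_coarse hN m 1 le_rfl hX' z hz
  refine h.near_S z₁ (hN.one.1.1 hz₁) y ?_
  refine (h.tri_le (hX' 1 le_rfl hk hz₁) hyX (hX' _ hk le_rfl hz) h1
    (hy.le.trans (h.pow_le hk))).trans ?_
  have h3 := h.one_le
  have h4 := h.pos
  nlinarith [mul_le_mul_of_nonneg_left h3 (mul_nonneg (zero_le_one.trans h3) h4.le)]

theorem net_subset (h : IsQuasiFrame ρ S Y X K δ) (hN : IsNetSequence ρ S δ net) (k : ℕ)
    (hk : 1 ≤ k) : net k ⊆ Y := by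
  induction k using Nat.strong_induction_on with
  | _ k ih =>
    intro y hy
    obtain ⟨k, rfl⟩ := Nat.exists_eq_add_of_le' hk
    rcases Nat.eq_zero_or_pos k with rfl | hk0
    · exact h.subY (hN.one.1.1 hy)
    · obtain ⟨z, hz, hzy⟩ := mem_iUnion₂.1 ((hN.succ k hk0).1.1 hy)
      exact h.mem_of_near_net hN hk0 (fun j h1 h2 => ih j (by omega) h1) hz hzy

theorem ball_net_subset (h : IsQuasiFrame ρ S Y X K δ) (hN : IsNetSequence ρ S δ net) {k : ℕ}
    (hk : 1 ≤ k) {z : Ω} (hz : z ∈ net k) : rhoBall ρ z (δ ^ k) ⊆ Y := fun _ hy =>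
  h.mem_of_near_net hN hk (fun j h1 _ => h.net_subset hN j h1) hz hy

/-- Each net is maximal in the union of the balls of the preceding generation, so nearness to one
net passes to the next. -/
theorem exists_net_near (h : IsQuasiFrame ρ S Y X K δ) (hN : IsNetSequence ρ S δ net) {k l : ℕ}
    (hk : 1 ≤ k) (hkl : k ≤ l) {x : Ω} (hx : ∃ z ∈ net k, ρ z x < δ ^ k) :
    ∃ w ∈ net l, ρ w x < δ ^ l := by
  induction l, hkl using Nat.le_induction with
  | base => exact hx
  | succ l hl ih =>
    obtain ⟨w, hw, hwx⟩ := ih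
    exact (hN.succ l (hk.trans hl)).exists_near h.self h.symm (h.pow_pos _)
      (mem_iUnion₂.2 ⟨w, hw, hwx⟩)

theorem exists_net_near_of_mem (h : IsQuasiFrame ρ S Y X K δ) (hN : IsNetSequence ρ S δ net)
    {l : ℕ} (hl : 1 ≤ l) {x : Ω} (hx : x ∈ S) : ∃ w ∈ net l, ρ w x < δ ^ l := by
  refine h.exists_net_near hN le_rfl hl ?_
  simpa using hN.one.exists_near h.self h.symm h.pos hx

theorem net_separated (hN : IsNetSequence ρ S δ net) {k : ℕ} (hk : 1 ≤ k) {z w : Ω}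
    (hz : z ∈ net k) (hw : w ∈ net k) (hzw : ρ z w < δ ^ k) : z = w := by
  by_contra hne
  obtain ⟨k, rfl⟩ := Nat.exists_eq_add_of_le' hk
  have hsep : δ ^ (k + 1) ≤ ρ z w := by
    rcases Nat.eq_zero_or_pos k with rfl | hk0
    · simpa using hN.one.1.2 hz hw hne
    · exact (hN.succ k hk0).1.2 hz hw hne
  linarith

/-! ### Existence of dyadic systems -/

/-- A choice of parent compatible with (T3) and (T4). Two net points within `(2 * b)⁻¹ * δ ^ k` of
`w` would be closer than `δ ^ k` to each other, so at most one parent is forced; if none is, any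
point whose ball contains `w` will do. -/
theorem exists_parent (h : IsQuasiFrame ρ S Y X K δ) (hN : IsNetSequence ρ S δ net) {b : ℝ}
    (hb : 1 ≤ b) (hbtri : ∀ x ∈ Y, ∀ y ∈ Y, ∀ z ∈ Y, ρ x y ≤ b * (ρ x z + ρ z y)) {k : ℕ}
    (hk : 1 ≤ k) {w : Ω} (hw : w ∈ net (k + 1)) :
    ∃ z ∈ net k, ρ w z < δ ^ k ∧ ∀ z' ∈ net k, ρ w z' < (2 * b)⁻¹ * δ ^ k → z' = z := by
  have hb0 : 0 < b := zero_lt_one.trans_le hb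
  have hwY := h.net_subset hN _ (by omega) hw
  by_cases hz : ∃ z ∈ net k, ρ w z < (2 * b)⁻¹ * δ ^ k
  · obtain ⟨z, hz, h1⟩ := hz
    refine ⟨z, hz, h1.trans_le ?_, fun z' hz' h2 => net_separated hN hk hz' hz ?_⟩
    · exact mul_le_of_le_one_left (h.pow_pos k).le (inv_le_one_of_one_le₀ (by linarith))
    · refine (hbtri z' (h.net_subset hN k hk hz') z (h.net_subset hN k hk hz) w hwY).trans_lt ?_
      rw [h.symm z' w]
      calc b * (ρ w z' + ρ w z) < b * ((2 * b)⁻¹ * δ ^ k + (2 * b)⁻¹ * δ ^ k) := by gcongr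
        _ = δ ^ k := by field_simp; ring
  · obtain ⟨z, hz', hzw⟩ := mem_iUnion₂.1 ((hN.succ k hk).1.1 hw)
    exact ⟨z, hz', by rw [h.symm]; exact hzw, fun z' h1 h2 => absurd ⟨z', h1, h2⟩ hz⟩

end IsQuasiFrame

/-- The ancestor of generation `k` of a point of generation `k + m`, for a map `P` that sends
a point of generation `j + 1` to its parent `P j w`. -/
def iterParent (P : ℕ → Ω → Ω) (k : ℕ) : ℕ → Ω → Ω
  | 0, w => w
  | m + 1, w => iterParent P k m (P (k + m) w)

theorem iterParent_add (P : ℕ → Ω → Ω) (k p m : ℕ) (w : Ω) :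
    iterParent P k p (iterParent P (k + p) m w) = iterParent P k (p + m) w := by
  induction m generalizing w with
  | zero => rfl
  | succ m ih =>
    change iterParent P k p (iterParent P (k + p) m (P (k + p + m) w)) =
      iterParent P k (p + m) (P (k + (p + m)) w)
    rw [ih, add_assoc]

theorem iterParent_mem {P : ℕ → Ω → Ω} (hP : ∀ k, 1 ≤ k → ∀ w ∈ net (k + 1), P k w ∈ net k)
    {k : ℕ} (hk : 1 ≤ k) (m : ℕ) : ∀ w ∈ net (k + m), iterParent P k m w ∈ net k := by
  induction m with
  | zero => exact fun w hw => hw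
  | succ m ih => exact fun w hw => ih _ (hP (k + m) (by omega) w hw)

theorem IsQuasiFrame.nonempty_dyadicSystem (h : IsQuasiFrame ρ S Y X K δ) {b : ℝ} (hb : 1 ≤ b)
    (hbtri : ∀ x ∈ Y, ∀ y ∈ Y, ∀ z ∈ Y, ρ x y ≤ b * (ρ x z + ρ z y)) :
    Nonempty (DyadicSystem ρ S b δ) := by
  obtain ⟨net, hN⟩ := exists_isNetSequence ρ S δ
  have hpar : ∀ (k : ℕ) (w : Ω), ∃ z, 1 ≤ k → w ∈ net (k + 1) →
      z ∈ net k ∧ ρ w z < δ ^ k ∧ ∀ z' ∈ net k, ρ w z' < (2 * b)⁻¹ * δ ^ k → z' = z := by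
    intro k w
    by_cases hkw : 1 ≤ k ∧ w ∈ net (k + 1)
    · obtain ⟨z, hz⟩ := h.exists_parent hN hb hbtri hkw.1 hkw.2
      exact ⟨z, fun _ _ => hz⟩
    · exact ⟨w, fun h1 h2 => absurd ⟨h1, h2⟩ hkw⟩
  choose P hP using hpar
  have hPmem : ∀ k, 1 ≤ k → ∀ w ∈ net (k + 1), P k w ∈ net k := fun k hk w hw => (hP k w hk hw).1
  refine ⟨{
    net := net
    net_one := hN.one
    net_succ := hN.succ
    le := fun l w k z => 1 ≤ k ∧ w ∈ net l ∧ ∃ m, l = k + m ∧ iterParent P k m w = z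
    le_mem := ?_
    le_refl := fun k z hk hz => ⟨hk, hz, 0, rfl, rfl⟩
    le_trans := ?_
    le_antisymm := ?_
    le_level := ?_
    existsUnique_ancestor := ?_
    dist_parent := ?_
    le_of_dist_lt := ?_ }⟩
  · rintro l w k z ⟨hk, hw, m, rfl, rfl⟩
    exact ⟨by omega, hw, hk, iterParent_mem hPmem hk m w hw⟩
  · rintro l w k z j y ⟨hk, hw, m, rfl, rfl⟩ ⟨hj, -, p, rfl, rfl⟩
    exact ⟨hj, hw, p + m, by omega, (iterParent_add P j p m w).symm⟩
  · rintro l w k z ⟨hk, hw, m, rfl, rfl⟩ ⟨-, -, p, hp, -⟩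
    obtain rfl : m = 0 := by omega
    exact ⟨rfl, rfl⟩
  · rintro l w k z ⟨-, -, m, rfl, -⟩
    omega
  · intro k z hz l hl hlk
    obtain ⟨m, rfl⟩ := Nat.exists_eq_add_of_le hlk
    refine ⟨_, ⟨hl, hz, m, rfl, rfl⟩, ?_⟩
    rintro y ⟨-, -, p, hp, rfl⟩
    obtain rfl : m = p := by omega
    rfl
  · rintro k z w ⟨hk, hz, m, hm, rfl⟩
    obtain rfl : m = 1 := by omega
    exact (hP k z hk hz).2.1
  · intro k hk z hz w hw hlt
    exact ⟨hk, hz, 1, rfl, ((hP k z hk hz).2.2 w hw hlt).symm⟩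

/-! ### Geometry of dyadic cubes -/

section Cubes

variable {b : ℝ}

namespace DyadicSystem

theorem le_unique (Q : DyadicSystem ρ S b δ) {l k : ℕ} {w z z' : Ω} (h : Q.le l w k z)
    (h' : Q.le l w k z') : z = z' := by
  obtain ⟨-, hw, hk, -⟩ := Q.le_mem _ _ _ _ h
  exact (Q.existsUnique_ancestor l w hw k hk (Q.le_level _ _ _ _ h)).unique h h'

theorem exists_between (Q : DyadicSystem ρ S b δ) {l j k : ℕ} {w z : Ω} (h : Q.le l w k z)
    (hkj : k ≤ j) (hjl : j ≤ l) : ∃ u, Q.le l w j u ∧ Q.le j u k z := by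
  obtain ⟨hl, hw, hk, -⟩ := Q.le_mem _ _ _ _ h
  obtain ⟨u, hu, -⟩ := Q.existsUnique_ancestor l w hw j (hk.trans hkj) hjl
  have huj := (Q.le_mem _ _ _ _ hu).2.2.2
  obtain ⟨z', hz', -⟩ := Q.existsUnique_ancestor j u huj k hk hkj
  obtain rfl := Q.le_unique h (Q.le_trans _ _ _ _ _ _ hu hz')
  exact ⟨u, hu, hz'⟩

theorem cube_subset_cube (Q : DyadicSystem ρ S b δ) {l k : ℕ} {w z : Ω} (h : Q.le l w k z) :
    Q.cube l w ⊆ Q.cube k z := by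
  intro x hx
  simp only [cube, mem_iUnion] at hx ⊢
  obtain ⟨i, u, hu, hx⟩ := hx
  exact ⟨i, u, Q.le_trans _ _ _ _ _ _ hu h, hx⟩

theorem ball_subset_cube (Q : DyadicSystem ρ S b δ) {l k : ℕ} {w z : Ω} (h : Q.le l w k z) :
    rhoBall ρ w (δ * δ ^ l) ⊆ Q.cube k z := fun x hx => by
  simp only [cube, mem_iUnion]
  exact ⟨l, w, h, hx⟩

end DyadicSystem

namespace IsQuasiFrame

theorem dist_le_of_le (h : IsQuasiFrame ρ S Y X K δ) (Q : DyadicSystem ρ S b δ) (m : ℕ) :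
    ∀ {k : ℕ} {w z : Ω}, Q.le (k + m) w k z → ρ z w ≤ 2 * K * δ ^ k := by
  have hnet := h.net_subset Q.isNetSequence
  induction m with
  | zero =>
    intro k w z hle
    obtain ⟨-, hw, hk, -⟩ := Q.le_mem _ _ _ _ hle
    rw [Q.le_unique hle (Q.le_refl _ _ hk hw), h.self]
    have := h.pow_pos k
    have := h.one_le
    positivity
  | succ m ih =>
    intro k w z hle
    obtain ⟨-, hw, hk, hz⟩ := Q.le_mem _ _ _ _ hle
    obtain ⟨u, hu, huz⟩ := Q.exists_between hle (Nat.le_succ k) (by omega)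
    have hum := (Q.le_mem _ _ _ _ hu).2.2.2
    have h1 := Q.dist_parent _ _ _ huz
    rw [h.symm] at h1
    have h2 := ih (k := k + 1) (by rwa [show k + 1 + m = k + (m + 1) by omega])
    have h1' := h.tri_le (h.subX (hnet k hk hz)) (h.subX (hnet _ (by omega) hw))
      (h.subX (hnet _ (by omega) hum)) h1.le h2
    refine h1'.trans ?_
    have h1 := h.two_mul_le
    have h2 := h.pow_pos k
    have h3 := h.one_le
    rw [pow_succ]
    nlinarith [mul_le_mul_of_nonneg_left h1 (mul_nonneg (zero_le_one.trans h3) h2.le)]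

theorem mul_pow_le (h : IsQuasiFrame ρ S Y X K δ) (k : ℕ) : δ * δ ^ k ≤ δ ^ k :=
  mul_le_of_le_one_left (h.pow_pos k).le h.lt_one.le

theorem cube_subset (h : IsQuasiFrame ρ S Y X K δ) (Q : DyadicSystem ρ S b δ) (k : ℕ) (z : Ω) :
    Q.cube k z ⊆ Y := by
  intro x hx
  simp only [DyadicSystem.cube, mem_iUnion] at hx
  obtain ⟨l, w, hle, hx⟩ := hx
  obtain ⟨hl, hw, -⟩ := Q.le_mem _ _ _ _ hle
  exact h.ball_net_subset Q.isNetSequence hl hw (lt_of_lt_of_le hx (h.mul_pow_le l))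

theorem dist_cube_le (h : IsQuasiFrame ρ S Y X K δ) (Q : DyadicSystem ρ S b δ) {k : ℕ} {z x : Ω}
    (hx : x ∈ Q.cube k z) : ρ z x ≤ 3 * K ^ 2 * δ ^ k := by
  have hxY := h.cube_subset Q k z hx
  simp only [DyadicSystem.cube, mem_iUnion] at hx
  obtain ⟨l, w, hle, hx⟩ := hx
  obtain ⟨hl, hw, hk, hz⟩ := Q.le_mem _ _ _ _ hle
  have hkl := Q.le_level _ _ _ _ hle
  obtain ⟨m, rfl⟩ := Nat.exists_eq_add_of_le hkl
  have hnet := h.net_subset Q.isNetSequence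
  have h1 : ρ w x ≤ δ ^ k := (le_of_lt hx).trans ((h.mul_pow_le _).trans (h.pow_anti hkl))
  refine (h.tri_le (h.subX (hnet k hk hz)) (h.subX hxY) (h.subX (hnet _ hl hw))
    (h.dist_le_of_le Q m hle) h1).trans ?_
  have h3 := h.one_le
  have h4 := h.pow_pos k
  nlinarith [mul_le_mul_of_nonneg_left h3 (mul_nonneg (zero_le_one.trans h3) h4.le)]

/-- Cubes of the same generation are disjoint; the two defining balls are ordered by generation. -/
theorem eq_of_balls_meet (h : IsQuasiFrame ρ S Y X K δ) (hb : 0 < b) (hbK : b ≤ K)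
    (Q : DyadicSystem ρ S b δ) {k m n : ℕ} {z z' u v x : Ω} (hu : Q.le m u k z)
    (hv : Q.le n v k z') (hmn : m ≤ n) (hxu : ρ u x < δ * δ ^ m) (hxv : ρ v x < δ * δ ^ n) :
    z = z' := by
  obtain ⟨hm, hum, hk, hz⟩ := Q.le_mem _ _ _ _ hu
  obtain ⟨hn, hvn, -, hz'⟩ := Q.le_mem _ _ _ _ hv
  have hnet := h.net_subset Q.isNetSequence
  have huX := h.subX (hnet _ hm hum)
  have hvX := h.subX (hnet _ hn hvn)
  have hxX : x ∈ X := h.subX (h.ball_net_subset Q.isNetSequence hm hum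
    (lt_of_lt_of_le hxu (h.mul_pow_le m)))
  have hK := h.one_le
  have hδ := h.pos
  have hmpos := h.pow_pos m
  have hvx : ρ x v ≤ δ * δ ^ m := by
    rw [h.symm]
    exact hxv.le.trans (mul_le_mul_of_nonneg_left (h.pow_anti hmn) hδ.le)
  have huv : ρ u v ≤ K * (δ * δ ^ m + δ * δ ^ m) := h.tri_le huX hvX hxX hxu.le hvx
  have hle : ∃ y, Q.le n v m y ∧ Q.le m y k z' :=
    Q.exists_between hv (Q.le_level _ _ _ _ hu) hmn
  obtain ⟨y, hvy, hyz'⟩ := hle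
  suffices hy : u = y by
    subst hy
    exact Q.le_unique hu hyz'
  have hpos : 0 < δ * δ ^ m := by positivity
  rcases hmn.eq_or_lt with rfl | hlt
  · obtain rfl := Q.le_unique hvy (Q.le_refl _ _ hn hvn)
    refine net_separated Q.isNetSequence hm hum hvn (huv.trans_lt ?_)
    have h1 : K ≤ K ^ 3 := le_self_pow₀ hK (by norm_num)
    have : 4 * K * δ ≤ 1 := by nlinarith [h.small, mul_le_mul_of_nonneg_right h1 hδ.le]
    nlinarith [mul_le_mul_of_nonneg_right this hmpos.le, mul_pos (zero_lt_one.trans_le hK) hpos]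
  -- The ancestor `ξ` of `v` in generation `m + 1` is so close to `u` that (T4) makes `u` its
  -- parent. Uniqueness of ancestors then gives `u = y`.
  · obtain ⟨ξ, hvξ, hξy⟩ := Q.exists_between hvy (Nat.le_succ m) hlt
    have hξ := (Q.le_mem _ _ _ _ hvξ).2.2.2
    have hξX := h.subX (hnet _ (by omega) hξ)
    obtain ⟨p, rfl⟩ := Nat.exists_eq_add_of_le (Nat.succ_le_of_lt hlt)
    have h1 : ρ v ξ ≤ 2 * K * (δ * δ ^ m) := by
      rw [h.symm, ← pow_succ']
      exact h.dist_le_of_le Q p hvξ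
    have h2 : ρ ξ u < (2 * b)⁻¹ * δ ^ m := by
      rw [h.symm]
      calc ρ u ξ ≤ K * (K * (δ * δ ^ m + δ * δ ^ m) + 2 * K * (δ * δ ^ m)) :=
            h.tri_le huX hξX hvX huv h1
        _ = (2 * K)⁻¹ * ((8 * K ^ 3 * δ) * δ ^ m) := by field_simp; ring
        _ < (2 * K)⁻¹ * δ ^ m := by
            refine mul_lt_mul_of_pos_left ?_ (by positivity)
            refine mul_lt_of_lt_one_left hmpos ?_
            have : 0 < K ^ 3 * δ := by positivity
            linarith [h.small]
        _ ≤ (2 * b)⁻¹ * δ ^ m := by gcongr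
    have h3 := Q.le_of_dist_lt m hm ξ hξ u hum h2
    exact Q.le_unique h3 hξy

theorem cube_eq_of_inter (h : IsQuasiFrame ρ S Y X K δ) (hb : 0 < b) (hbK : b ≤ K)
    (Q : DyadicSystem ρ S b δ) {k : ℕ} {z z' x : Ω} (hx : x ∈ Q.cube k z) (hx' : x ∈ Q.cube k z') :
    z = z' := by
  simp only [DyadicSystem.cube, mem_iUnion] at hx hx'
  obtain ⟨m, u, hu, hxu⟩ := hx
  obtain ⟨n, v, hv, hxv⟩ := hx'
  rcases le_total m n with hmn | hmn
  · exact h.eq_of_balls_meet hb hbK Q hu hv hmn hxu hxv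
  · exact (h.eq_of_balls_meet hb hbK Q hv hu hmn hxv hxu).symm

theorem le_of_cube_inter (h : IsQuasiFrame ρ S Y X K δ) (hb : 0 < b) (hbK : b ≤ K)
    (Q : DyadicSystem ρ S b δ) {k j : ℕ} {z u x : Ω} (hk : 1 ≤ k) (hkj : k ≤ j) (hu : u ∈ Q.net j)
    (hx : x ∈ Q.cube k z) (hx' : x ∈ Q.cube j u) : Q.le j u k z := by
  obtain ⟨z', hz', -⟩ := Q.existsUnique_ancestor j u hu k hk hkj
  rwa [h.cube_eq_of_inter hb hbK Q hx (Q.cube_subset_cube hz' hx')]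

section Topology

variable [TopologicalSpace Ω]

/-- The union of the cubes of generation `j` is dense near the net of generation `j`. -/
theorem exists_mem_cube_of_isOpen (h : IsQuasiFrame ρ S Y X K δ) (Q : DyadicSystem ρ S b δ)
    (hopen : ∀ A : Set Ω, IsOpen A → ∀ x ∈ A, ∃ r > 0, rhoBall ρ x r ⊆ A) {j : ℕ} (hj : 1 ≤ j)
    {x : Ω} (hx : ∃ w ∈ Q.net j, ρ w x < δ ^ j) {V : Set Ω} (hV : IsOpen V) (hxV : x ∈ V) :
    ∃ u ∈ Q.net j, ∃ y ∈ V, y ∈ Q.cube j u := by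
  obtain ⟨r, hr, hrV⟩ := hopen V hV x hxV
  obtain ⟨i, hi⟩ := exists_pow_lt_of_lt_one hr h.lt_one
  obtain ⟨w, hw, hwx⟩ := h.exists_net_near Q.isNetSequence hj (le_max_left j i) hx
  obtain ⟨u, hu, -⟩ := Q.existsUnique_ancestor _ w hw j hj (le_max_left j i)
  refine ⟨u, (Q.le_mem _ _ _ _ hu).2.2.2, w, hrV ?_, Q.ball_subset_cube hu ?_⟩
  · change ρ x w < r
    rw [h.symm]
    exact (hwx.trans_le (h.pow_anti (le_max_right j i))).trans hi
  · change ρ w w < _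
    rw [h.self]
    exact mul_pos h.pos (h.pow_pos _)

/-- Every point of a cube is close, at each finer scale, to a descendant of its centre. -/
theorem exists_le_near (h : IsQuasiFrame ρ S Y X K δ) (hb : 0 < b) (hbK : b ≤ K)
    (Q : DyadicSystem ρ S b δ)
    (hopen : ∀ A : Set Ω, IsOpen A → ∀ x ∈ A, ∃ r > 0, rhoBall ρ x r ⊆ A)
    (hball : ∀ x r, 0 < r → IsOpen (rhoBall ρ x r)) {k j : ℕ} (hkj : k ≤ j) {z x : Ω}
    (hx : x ∈ Q.cube k z) : ∃ u, Q.le j u k z ∧ ρ u x ≤ 4 * K ^ 3 * δ ^ j := by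
  have hK := h.one_le
  have hjpos := h.pow_pos j
  have h23 : K ^ 2 ≤ K ^ 3 := pow_le_pow_right₀ hK (by norm_num)
  have hxY := h.cube_subset Q k z hx
  have hx₀ := hx
  simp only [DyadicSystem.cube, mem_iUnion] at hx
  obtain ⟨l, w, hle, hxw⟩ := hx
  obtain ⟨hl, hw, hk, hz⟩ := Q.le_mem _ _ _ _ hle
  rcases le_total j l with hjl | hlj
  -- The scale `j` is no finer than the ball containing `x`: the ancestor of its centre in
  -- generation `j` has a cube containing `x`.
  · obtain ⟨u, hwu, huz⟩ := Q.exists_between hle hkj hjl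
    refine ⟨u, huz, (h.dist_cube_le Q (Q.ball_subset_cube hwu hxw)).trans ?_⟩
    have : 0 ≤ K ^ 3 := by positivity
    gcongr
    linarith
  -- At finer scales `x` itself may lie in no cube of generation `j`. By density some such cube
  -- meets the defining ball of `x` within `δ ^ j` of `x`, and disjointness makes its centre a
  -- descendant of `z`.
  · have hnear : ∃ w ∈ Q.net j, ρ w x < δ ^ j := h.exists_net_near Q.isNetSequence hl hlj
      ⟨w, hw, lt_of_lt_of_le hxw (h.mul_pow_le l)⟩
    have hδl : 0 < δ * δ ^ l := mul_pos h.pos (h.pow_pos l)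
    obtain ⟨u, hu, y, ⟨hyw, hyx⟩, hyu⟩ := h.exists_mem_cube_of_isOpen Q hopen (hk.trans hkj) hnear
      ((hball w _ hδl).inter (hball x _ hjpos))
      ⟨hxw, show ρ x x < δ ^ j by rw [h.self]; exact hjpos⟩
    have huz := h.le_of_cube_inter hb hbK Q hk hkj hu (Q.ball_subset_cube hle hyw) hyu
    refine ⟨u, huz, ?_⟩
    have hyx' : ρ y x ≤ δ ^ j := by rw [h.symm]; exact le_of_lt hyx
    refine (h.tri_le (h.subX (h.net_subset Q.isNetSequence j (hk.trans hkj) hu)) (h.subX hxY)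
      (h.subX (h.cube_subset Q j u hyu)) (h.dist_cube_le Q hyu) hyx').trans ?_
    have hK3 : K ≤ K ^ 3 := le_self_pow₀ hK (by norm_num)
    nlinarith [mul_le_mul_of_nonneg_right hK3 hjpos.le]

end Topology

end IsQuasiFrame

end Cubes

end Frame

/-! ### Doubling measures -/

/-- The doubling condition at the points of `Y`, at scales up to `ε`. -/
def IsDoublingOn {Ω : Type*} [MeasurableSpace Ω] (ρ : Ω → Ω → ℝ) (μ : Measure Ω) (Y : Set Ω)
    (ε C : ℝ) : Prop :=
  ∀ x ∈ Y, ∀ r, 0 < r → r ≤ ε →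
    0 < μ (rhoBall ρ x (2 * r)) ∧
    μ (rhoBall ρ x (2 * r)) ≤ ENNReal.ofReal C * μ (rhoBall ρ x r) ∧
    μ (rhoBall ρ x r) < ∞

theorem rhoBall_subset_rhoBall {Ω : Type*} {ρ : Ω → Ω → ℝ} {x : Ω} {r s : ℝ} (h : r ≤ s) :
    rhoBall ρ x r ⊆ rhoBall ρ x s := fun _ hy => lt_of_lt_of_le hy h

section Doubling

variable {Ω : Type*} [MeasurableSpace Ω] {ρ : Ω → Ω → ℝ} {μ : Measure Ω} {Y : Set Ω} {ε C : ℝ}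

namespace IsDoublingOn

theorem iterate (h : IsDoublingOn ρ μ Y ε C) (hC : 0 ≤ C) {x : Ω} (hx : x ∈ Y) (p : ℕ) :
    ∀ {r : ℝ}, 0 < r → 2 ^ p * r ≤ ε →
      μ (rhoBall ρ x (2 ^ p * r)) ≤ ENNReal.ofReal (C ^ p) * μ (rhoBall ρ x r) := by
  induction p with
  | zero => intro r _ _; simp
  | succ p ih =>
    intro r hr hrε
    have h1 : (0 : ℝ) < 2 ^ p * r := by positivity
    rw [pow_succ'] at hrε
    have h2 : 2 ^ p * r ≤ ε := by linarith
    rw [pow_succ', mul_assoc, pow_succ', ENNReal.ofReal_mul hC, mul_assoc]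
    exact (h x hx _ h1 h2).2.1.trans (mul_le_mul_right (ih hr h2) _)

theorem pos (h : IsDoublingOn ρ μ Y ε C) {x : Ω} (hx : x ∈ Y) {r : ℝ} (hr : 0 < r) (hrε : r ≤ ε) :
    0 < μ (rhoBall ρ x r) := by
  have := (h x hx (r / 2) (by linarith) (by linarith)).1
  rwa [mul_div_cancel₀ _ (two_ne_zero)] at this

end IsDoublingOn

end Doubling

theorem IsQuasiFrame.isOpen_cube {Ω : Type*} [TopologicalSpace Ω] {ρ : Ω → Ω → ℝ} {S Y X : Set Ω}
    {K δ b : ℝ} (h : IsQuasiFrame ρ S Y X K δ)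
    (hball : ∀ x r, 0 < r → IsOpen (rhoBall ρ x r)) (Q : DyadicSystem ρ S b δ) (k : ℕ)
    (w : Ω) : IsOpen (Q.cube k w) :=
  isOpen_iUnion fun l => isOpen_iUnion fun _ => isOpen_iUnion fun _ =>
    hball _ _ (mul_pos h.pos (h.pow_pos l))

/-! ### The cubes of one generation cover almost everything -/

section Null

variable {Ω : Type*} [TopologicalSpace Ω] [MeasurableSpace Ω] [BorelSpace Ω] {ρ : Ω → Ω → ℝ}
  {μ : Measure Ω} {S Y X : Set Ω} {K δ ε C b : ℝ}

/-- The union of all cubes of generation `k`. -/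
def DyadicSystem.allCubes (Q : DyadicSystem ρ S b δ) (k : ℕ) : Set Ω := ⋃ w ∈ Q.net k, Q.cube k w

namespace IsQuasiFrame

/-- Near each uncovered point there are arbitrarily small balls about net points that lie both in
`V` and in a cube of generation `k`. A disjoint subfamily, enlarged by the factor `2 ^ p`, covers
the uncovered set, and doubling compares the measures. -/
theorem measure_diff_le (h : IsQuasiFrame ρ S Y X K δ) (Q : DyadicSystem ρ S b δ)
    (hopen : ∀ A : Set Ω, IsOpen A → ∀ x ∈ A, ∃ r > 0, rhoBall ρ x r ⊆ A)
    (hball : ∀ x r, 0 < r → IsOpen (rhoBall ρ x r)) (hd : IsDoublingOn ρ μ Y ε C) (hε : 0 < ε)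
    (hC : 0 ≤ C) (hY : μ Y < ∞) {p : ℕ} (hp : 6 * K ^ 2 ≤ 2 ^ p * δ) {k : ℕ} (hk : 1 ≤ k)
    {V : Set Ω} (hV : IsOpen V) (hSV : S \ Q.allCubes k ⊆ V) :
    μ (S \ Q.allCubes k) ≤ ENNReal.ofReal (C ^ p) * μ (V ∩ Q.allCubes k) := by
  have hK := h.one_le
  have hδ := h.pos
  have hnet := h.net_subset Q.isNetSequence
  have hex : ∀ x ∈ S \ Q.allCubes k, ∃ (i : ℕ) (z : Ω), k ≤ i ∧ 2 ^ p * (δ * δ ^ i) ≤ ε ∧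
      z ∈ Q.net i ∧ ρ z x < δ ^ i ∧ rhoBall ρ z (δ * δ ^ i) ⊆ V := by
    intro x hx
    obtain ⟨r, hr, hrV⟩ := hopen V hV x (hSV hx)
    obtain ⟨i₁, hi₁⟩ := exists_pow_lt_of_lt_one (show 0 < r / (2 * K) by positivity) h.lt_one
    obtain ⟨i₂, hi₂⟩ := exists_pow_lt_of_lt_one (show 0 < ε / 2 ^ p by positivity) h.lt_one
    let i := max k (max i₁ i₂)
    have hki : k ≤ i := le_max_left _ _
    have h1 : δ ^ i < r / (2 * K) := (h.pow_anti (by omega)).trans_lt hi₁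
    have h2 : δ ^ i < ε / 2 ^ p := (h.pow_anti (by omega)).trans_lt hi₂
    obtain ⟨z, hz, hzx⟩ := h.exists_net_near_of_mem Q.isNetSequence (hk.trans hki) hx.1
    refine ⟨i, z, hki, ?_, hz, hzx, fun y hy => hrV ?_⟩
    · rw [lt_div_iff₀ (by positivity)] at h2
      have := h.mul_pow_le i
      have : 2 ^ p * (δ * δ ^ i) ≤ 2 ^ p * δ ^ i := by gcongr
      linarith
    · have hy' : ρ z y < δ ^ i := lt_of_lt_of_le hy (h.mul_pow_le i)
      have hyX := h.subX (h.ball_net_subset Q.isNetSequence (hk.trans hki) hz hy')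
      rw [h.symm] at hzx
      refine (h.tri_le (h.subX (h.subY hx.1)) hyX (h.subX (hnet i (hk.trans hki) hz)) hzx.le
        hy'.le).trans_lt ?_
      rw [lt_div_iff₀ (by positivity)] at h1
      linarith
  choose! i z hki hiε hz hzx hzV using hex
  let P : Ω → Set Ω := fun x => rhoBall ρ (z x) (δ * δ ^ i x)
  have hPpos : ∀ x, 0 < δ * δ ^ i x := fun x => mul_pos hδ (h.pow_pos _)
  have hPne : ∀ x ∈ S \ Q.allCubes k, (P x).Nonempty := fun x _ =>
    ⟨z x, show ρ (z x) (z x) < _ by rw [h.self]; exact hPpos x⟩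
  obtain ⟨u, huN, hudisj, hu⟩ := Vitali.exists_disjoint_subfamily_covering_enlargement P
    (S \ Q.allCubes k) (fun x => δ ^ i x) 2 one_lt_two (fun x _ => (h.pow_pos _).le) 1
    (fun x _ => pow_le_one₀ hδ.le h.lt_one.le) hPne
  have hPY : ∀ x ∈ u, P x ⊆ Y := fun x hx y hy =>
    h.ball_net_subset Q.isNetSequence (hk.trans (hki x (huN hx))) (hz x (huN hx))
      (lt_of_lt_of_le hy (h.mul_pow_le _))
  have hzY : ∀ x ∈ u, z x ∈ Y := fun x hx => hnet _ (hk.trans (hki x (huN hx))) (hz x (huN hx))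
  have hPm : ∀ x, MeasurableSet (P x) := fun x => (hball _ _ (hPpos x)).measurableSet
  -- Disjoint sets of positive measure inside the set `Y` of finite measure.
  have hcount : u.Countable := by
    have : IsFiniteMeasure (μ.restrict Y) := ⟨by simpa using hY⟩
    have hc := Measure.countable_meas_pos_of_disjoint_iUnion (μ := μ.restrict Y)
      (As := fun x : u => P x) (fun x => hPm x) (fun x y hxy => hudisj x.2 y.2
        (fun e => hxy (Subtype.ext e)))
    have huniv : {x : u | 0 < μ.restrict Y (P x)} = univ := by
      refine eq_univ_of_forall fun x => ?_
      change 0 < μ.restrict Y (P x)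
      rw [Measure.restrict_apply (hPm x), inter_eq_left.2 (hPY x x.2)]
      have h2 : (1 : ℝ) ≤ 2 ^ p := one_le_pow₀ one_le_two
      exact hd.pos (hzY x x.2) (hPpos x)
        ((le_mul_of_one_le_left (hPpos x).le h2).trans (hiε x (huN x.2)))
    rw [huniv] at hc
    exact countable_coe_iff.1 (countable_univ_iff.1 hc)
  have hcover : S \ Q.allCubes k ⊆ ⋃ y ∈ u, rhoBall ρ (z y) (2 ^ p * (δ * δ ^ i y)) := by
    intro x hx
    obtain ⟨y, hy, ⟨q, hqx, hqy⟩, hxy⟩ := hu x hx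
    refine mem_iUnion₂.2 ⟨y, hy, ?_⟩
    have hyp := h.pow_pos (i y)
    have hxX := h.subX (h.subY hx.1)
    have hqX := h.subX (hPY y hy hqy)
    have h1 : ρ q x ≤ K * (δ ^ i x + δ ^ i x) := by
      refine h.tri_le hqX hxX (h.subX (hnet _ (hk.trans (hki x hx)) (hz x hx))) ?_ (hzx x hx).le
      rw [h.symm]
      exact (le_of_lt hqx).trans (h.mul_pow_le _)
    have h2 : ρ q x ≤ K * (4 * δ ^ i y) := h1.trans (by gcongr; linarith)
    change ρ (z y) x < _
    refine (h.tri_le (h.subX (hzY y hy)) hxX hqX ((le_of_lt hqy).trans (h.mul_pow_le _)) h2).trans_lt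
      ?_
    -- The chain from `z y` through `q` to `x` has length at most `K * (1 + 4 * K) * δ ^ i y`, where
    -- the 4 contains the factor 2 of the Vitali selection. This is below `6 * K ^ 2 * δ ^ i y`.
    have h3 : 6 * K ^ 2 * δ ^ i y ≤ 2 ^ p * δ * δ ^ i y := by gcongr
    nlinarith [mul_le_mul_of_nonneg_left hK (mul_nonneg (zero_le_one.trans hK) hyp.le),
      mul_pos (mul_pos (zero_lt_one.trans_le hK) (zero_lt_one.trans_le hK)) hyp]
  have hPU : (⋃ y ∈ u, P y) ⊆ V ∩ Q.allCubes k := by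
    refine iUnion₂_subset fun y hy => subset_inter (hzV y (huN hy)) ?_
    obtain ⟨w, hw, -⟩ := Q.existsUnique_ancestor _ (z y) (hz y (huN hy)) k hk (hki y (huN hy))
    exact (Q.ball_subset_cube hw).trans
      (subset_iUnion₂_of_subset w (Q.le_mem _ _ _ _ hw).2.2.2 subset_rfl)
  calc μ (S \ Q.allCubes k) ≤ μ (⋃ y ∈ u, rhoBall ρ (z y) (2 ^ p * (δ * δ ^ i y))) :=
        measure_mono hcover
    _ ≤ ∑' y : u, μ (rhoBall ρ (z y) (2 ^ p * (δ * δ ^ i y))) := measure_biUnion_le μ hcount _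
    _ ≤ ∑' y : u, ENNReal.ofReal (C ^ p) * μ (P y) := by
        gcongr with y
        exact hd.iterate hC (hzY y y.2) p (hPpos y) (hiε y (huN y.2))
    _ = ENNReal.ofReal (C ^ p) * μ (⋃ y ∈ u, P y) := by
        rw [ENNReal.tsum_mul_left, measure_biUnion hcount hudisj fun y _ => hPm y]
    _ ≤ ENNReal.ofReal (C ^ p) * μ (V ∩ Q.allCubes k) := by gcongr

/-- Let `N` be the uncovered set. For open `V ⊇ N` the part of `V` in the cubes lies in `V \ N`,
whose measure is arbitrarily small by outer regularity. The previous estimate then forces `μ N = 0`,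
without any differentiation theorem. -/
theorem measure_diff_eq_zero (h : IsQuasiFrame ρ S Y X K δ) (Q : DyadicSystem ρ S b δ)
    (hopen : ∀ A : Set Ω, IsOpen A → ∀ x ∈ A, ∃ r > 0, rhoBall ρ x r ⊆ A)
    (hball : ∀ x r, 0 < r → IsOpen (rhoBall ρ x r)) (hd : IsDoublingOn ρ μ Y ε C) (hε : 0 < ε)
    (hC : 0 ≤ C) (hY : μ Y < ∞) [μ.OuterRegular] (hS : MeasurableSet S) {k : ℕ} (hk : 1 ≤ k) :
    μ (S \ Q.allCubes k) = 0 := by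
  obtain ⟨p, hp⟩ := pow_unbounded_of_one_lt (6 * K ^ 2 / δ) one_lt_two
  have hp : 6 * K ^ 2 ≤ 2 ^ p * δ := by
    rw [div_lt_iff₀ h.pos] at hp
    exact hp.le
  have hUm : IsOpen (Q.allCubes k) :=
    isOpen_iUnion fun w => isOpen_iUnion fun _ => h.isOpen_cube hball Q k w
  have hNm : MeasurableSet (S \ Q.allCubes k) := hS.diff hUm.measurableSet
  have hNfin : μ (S \ Q.allCubes k) ≠ ∞ :=
    ((measure_mono (sdiff_subset.trans h.subY)).trans_lt hY).ne
  have key : ∀ η : ℝ≥0∞, η ≠ 0 → μ (S \ Q.allCubes k) ≤ ENNReal.ofReal (C ^ p) * η := by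
    intro η hη
    obtain ⟨V, hNV, hV, -, hVη⟩ := hNm.exists_isOpen_sdiff_lt hNfin hη
    refine (h.measure_diff_le Q hopen hball hd hε hC hY hp hk hV hNV).trans ?_
    gcongr
    refine (measure_mono ?_).trans hVη.le
    exact fun y hy => ⟨hy.1, fun hyN => hyN.2 hy.2⟩
  refine le_antisymm ?_ zero_le
  have ht : Tendsto (fun η : ℝ≥0∞ => ENNReal.ofReal (C ^ p) * η) (𝓝[≠] 0) (𝓝 0) := by
    have := (ENNReal.continuous_const_mul (a := ENNReal.ofReal (C ^ p))
      ENNReal.ofReal_ne_top).tendsto 0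
    rw [mul_zero] at this
    exact this.mono_left nhdsWithin_le_nhds
  exact ge_of_tendsto ht (eventually_mem_nhdsWithin.mono key)

end IsQuasiFrame

end Null

/-! ### Mean oscillation -/

section Oscillation

variable {Ω : Type*} [MeasurableSpace Ω] {μ : Measure Ω}

/-- Replacing the mean by `a` costs `|a - f_A|`, which is at most the mean of `|f - a|`; hence the
factor 2. -/
theorem meanOsc_le_two_mul {f : Ω → ℝ} {A : Set Ω} (hA : μ A ≠ ∞) (hA₀ : μ A ≠ 0)
    (hf : IntegrableOn f A μ) (a : ℝ) :
    meanOsc μ f A ≤ 2 * ((μ A)⁻¹ * ∫⁻ y in A, ‖f y - a‖ₑ ∂μ) := by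
  have : IsFiniteMeasure (μ.restrict A) := ⟨by simpa using hA.lt_top⟩
  set I : ℝ≥0∞ := ∫⁻ y in A, ‖f y - a‖ₑ ∂μ with hI
  have hmean : ‖a - ⨍ z in A, f z ∂μ‖ₑ ≤ (μ A)⁻¹ * I := by
    have hconst : ⨍ _ in A, a ∂μ = a := setAverage_const hA₀ hA a
    have hsub : (⨍ z in A, (f z - a) ∂μ) = (⨍ z in A, f z ∂μ) - a := by
      have h1 : ∫ z in A, (f z - a) ∂μ = (∫ z in A, f z ∂μ) - ∫ _ in A, a ∂μ :=
        integral_sub hf (integrable_const a)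
      rw [setAverage_eq, h1, smul_sub, ← setAverage_eq, ← setAverage_eq, hconst]
    rw [← enorm_neg, neg_sub, ← hsub, setAverage_eq, enorm_smul]
    gcongr
    · rw [Real.enorm_of_nonneg (by positivity), measureReal_def, ← ENNReal.toReal_inv,
        ENNReal.ofReal_toReal (ENNReal.inv_ne_top.2 hA₀)]
    · exact enorm_integral_le_lintegral_enorm _
  have hsum : ∫⁻ y in A, ‖f y - ⨍ z in A, f z ∂μ‖ₑ ∂μ ≤ I + (μ A)⁻¹ * I * μ A := by
    calc ∫⁻ y in A, ‖f y - ⨍ z in A, f z ∂μ‖ₑ ∂μ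
        ≤ ∫⁻ y in A, (‖f y - a‖ₑ + (μ A)⁻¹ * I) ∂μ := by
          refine lintegral_mono fun y => ?_
          rw [← sub_add_sub_cancel (f y) a]
          exact (enorm_add_le _ _).trans (by gcongr)
      _ = I + (μ A)⁻¹ * I * μ A := by
          rw [lintegral_add_right _ measurable_const, lintegral_const,
            Measure.restrict_apply_univ]
  have hcancel : (μ A)⁻¹ * I * μ A = I := by
    rw [mul_comm, ← mul_assoc, ENNReal.mul_inv_cancel hA₀ hA, one_mul]
  rw [hcancel, ← two_mul] at hsum
  calc meanOsc μ f A ≤ (μ A)⁻¹ * (2 * I) := by unfold meanOsc; gcongr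
    _ = 2 * ((μ A)⁻¹ * I) := by ring

/-- The mean oscillation over a subset of comparable measure. -/
theorem meanOsc_le_of_subset {f : Ω → ℝ} {A V : Set Ω} (hAV : A ⊆ V) (hV : μ V ≠ ∞) (hA₀ : μ A ≠ 0)
    (hf : IntegrableOn f V μ) {M : ℝ≥0∞} (hVA : μ V ≤ M * μ A) :
    meanOsc μ f A ≤ 2 * M * meanOsc μ f V := by
  have hA : μ A ≠ ∞ := ((measure_mono hAV).trans_lt hV.lt_top).ne
  have hV₀ : μ V ≠ 0 := fun h0 => hA₀ (measure_mono_null hAV h0)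
  refine (meanOsc_le_two_mul hA hA₀ (hf.mono_set hAV) (⨍ z in V, f z ∂μ)).trans ?_
  have hinv : (μ A)⁻¹ ≤ M * (μ V)⁻¹ := by
    calc (μ A)⁻¹ = (μ A)⁻¹ * (μ V * (μ V)⁻¹) := by rw [ENNReal.mul_inv_cancel hV₀ hV, mul_one]
      _ ≤ (μ A)⁻¹ * (M * μ A * (μ V)⁻¹) := by gcongr
      _ = (μ A * (μ A)⁻¹) * (M * (μ V)⁻¹) := by ring
      _ = M * (μ V)⁻¹ := by rw [ENNReal.mul_inv_cancel hA₀ hA, one_mul]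
  rw [mul_assoc]
  refine mul_le_mul_right ?_ 2
  calc (μ A)⁻¹ * ∫⁻ y in A, ‖f y - ⨍ z in V, f z ∂μ‖ₑ ∂μ
      ≤ (M * (μ V)⁻¹) * ∫⁻ y in V, ‖f y - ⨍ z in V, f z ∂μ‖ₑ ∂μ :=
        mul_le_mul' hinv (lintegral_mono_set hAV)
    _ = M * meanOsc μ f V := by unfold meanOsc; ring

end Oscillation

/-! ### Geometry of dyadic sets -/

section DyadicSets

variable {Ω : Type*} {ρ : Ω → Ω → ℝ} {S Y X : Set Ω} {K δ b h L M : ℝ}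

theorem DyadicSystem.mem_cubesMeeting {Q : DyadicSystem ρ S b δ} {k : ℕ} {A : Set Ω} {y : Ω} :
    y ∈ Q.cubesMeeting k A ↔ ∃ w ∈ Q.net k, (Q.cube k w ∩ A).Nonempty ∧ y ∈ Q.cube k w := by
  simp only [DyadicSystem.cubesMeeting, mem_iUnion, exists_prop]

namespace IsQuasiFrame

theorem cubesMeeting_subset (hF : IsQuasiFrame ρ S Y X K δ) (Q : DyadicSystem ρ S b δ) (k : ℕ)
    (A : Set Ω) : Q.cubesMeeting k A ⊆ Y := by
  intro y hy
  obtain ⟨w, -, -, hyw⟩ := DyadicSystem.mem_cubesMeeting.1 hy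
  exact hF.cube_subset Q k w hyw

theorem dist_centre_le (hF : IsQuasiFrame ρ S Y X K δ) (Q : DyadicSystem ρ S b δ) {k : ℕ} {z y : Ω}
    (hz : z ∈ S) (hy : y ∈ Q.cubesMeeting k (rhoBall ρ z (h * δ ^ k))) :
    ρ z y ≤ K * (h + 6 * K ^ 3) * δ ^ k := by
  obtain ⟨w, hw, ⟨q, hqw, hzq⟩, hyw⟩ := DyadicSystem.mem_cubesMeeting.1 hy
  have hqX := hF.subX (hF.cube_subset Q k w hqw)
  have hyX := hF.subX (hF.cube_subset Q k w hyw)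
  have hwX : w ∈ X := by
    rcases Nat.eq_zero_or_pos k with rfl | hk
    · simp only [DyadicSystem.cube, mem_iUnion] at hyw
      obtain ⟨l, u, hle, -⟩ := hyw
      exact absurd (Q.le_mem _ _ _ _ hle).2.2.1 (by norm_num)
    · exact hF.subX (hF.net_subset Q.isNetSequence k hk hw)
  have h1 := hF.dist_cube_le Q hqw
  rw [hF.symm] at h1
  have h2 := hF.tri_le hqX hyX hwX h1 (hF.dist_cube_le Q hyw)
  refine (hF.tri_le (hF.subX (hF.subY hz)) hyX hqX (le_of_lt hzq) h2).trans (le_of_eq ?_)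
  ring

theorem dist_cubesMeeting_le (hF : IsQuasiFrame ρ S Y X K δ) (Q : DyadicSystem ρ S b δ) {k : ℕ}
    {z y y' : Ω} (hL : L = K * (h + 6 * K ^ 3)) (hz : z ∈ S)
    (hy : y ∈ Q.cubesMeeting k (rhoBall ρ z (h * δ ^ k)))
    (hy' : y' ∈ Q.cubesMeeting k (rhoBall ρ z (h * δ ^ k))) : ρ y y' ≤ 2 * K * L * δ ^ k := by
  have h1 := hF.dist_centre_le Q hz hy
  rw [hF.symm, ← hL] at h1
  have h2 := hF.dist_centre_le Q hz hy'
  rw [← hL] at h2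
  refine (hF.tri_le (hF.subX (hF.cubesMeeting_subset Q k _ hy))
    (hF.subX (hF.cubesMeeting_subset Q k _ hy')) (hF.subX (hF.subY hz)) h1 h2).trans (le_of_eq ?_)
  ring

variable [TopologicalSpace Ω]

/-- A ball of a dyadic set contains, and is contained in, concentric balls of comparable radii. -/
theorem exists_balls (hF : IsQuasiFrame ρ S Y X K δ) (hb : 0 < b) (hbK : b ≤ K)
    (Q : DyadicSystem ρ S b δ)
    (hopen : ∀ A : Set Ω, IsOpen A → ∀ x ∈ A, ∃ r > 0, rhoBall ρ x r ⊆ A)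
    (hball : ∀ x r, 0 < r → IsOpen (rhoBall ρ x r)) {k : ℕ} {z x : Ω}
    (hL : L = K * (h + 6 * K ^ 3)) (hL₀ : 0 ≤ L) (hM : 2 * K * L + 14 * K ^ 5 < M) {p : ℕ}
    (hp : M ≤ 2 ^ p * δ ^ 2) (hz : z ∈ S)
    (hx : x ∈ Q.cubesMeeting k (rhoBall ρ z (h * δ ^ k))) {r : ℝ} (hr : 0 < r) :
    ∃ u ∈ Y, ∃ s, 0 < s ∧ s ≤ δ ^ (k + 1) ∧
      rhoBall ρ u s ⊆ rhoBall ρ x r ∩ Q.cubesMeeting k (rhoBall ρ z (h * δ ^ k)) ∧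
      rhoBall ρ x (2 * r) ∩ Q.cubesMeeting k (rhoBall ρ z (h * δ ^ k)) ⊆
        rhoBall ρ u (2 ^ p * s) := by
  have hK := hF.one_le
  have hδ := hF.pos
  have hδ1 := hF.lt_one
  obtain ⟨w, hw, hwA, hxw⟩ := DyadicSystem.mem_cubesMeeting.1 hx
  have hxX := hF.subX (hF.cube_subset Q k w hxw)
  have hK34 : K ^ 3 ≤ K ^ 4 := pow_le_pow_right₀ hK (by norm_num)
  have hK4 : 4 * K ^ 4 + K ≤ 5 * K ^ 4 := by
    have : K ≤ K ^ 4 := le_self_pow₀ hK (by norm_num)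
    linarith
  -- The least such `j` gives the largest usable scale. The constant leaves room for `4 * K ^ 3 * δ
  -- ^ j` from `x` to `u` plus `δ ^ j` for the ball about `u`.
  have hexj : ∃ j, k ≤ j ∧ 5 * K ^ 4 * δ ^ j ≤ r := by
    obtain ⟨i, hi⟩ := exists_pow_lt_of_lt_one (show 0 < r / (5 * K ^ 4) by positivity) hδ1
    refine ⟨max k i, le_max_left _ _, ?_⟩
    rw [lt_div_iff₀ (by positivity)] at hi
    have : δ ^ max k i * (5 * K ^ 4) ≤ δ ^ i * (5 * K ^ 4) := by
      gcongr ?_ * _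
      exact hF.pow_anti (le_max_right _ _)
    linarith
  classical
  let j := Nat.find hexj
  have hj : k ≤ j ∧ 5 * K ^ 4 * δ ^ j ≤ r := Nat.find_spec hexj
  have hjmin : ∀ i, i < j → ¬(k ≤ i ∧ 5 * K ^ 4 * δ ^ i ≤ r) := fun i hi => Nat.find_min hexj hi
  obtain ⟨u, huw, hux⟩ := hF.exists_le_near hb hbK Q hopen hball hj.1 hxw
  obtain ⟨hj1, huj, -⟩ := Q.le_mem _ _ _ _ huw
  have huY := hF.net_subset Q.isNetSequence j hj1 huj
  have huX := hF.subX huY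
  have hcubeF : Q.cube k w ⊆ Q.cubesMeeting k (rhoBall ρ z (h * δ ^ k)) := fun y hy =>
    DyadicSystem.mem_cubesMeeting.2 ⟨w, hw, hwA, hy⟩
  have hballu := Q.ball_subset_cube huw
  have hs : 0 < δ * δ ^ j := mul_pos hδ (hF.pow_pos j)
  have huF : u ∈ Q.cubesMeeting k (rhoBall ρ z (h * δ ^ k)) :=
    hcubeF (hballu (show ρ u u < _ by rw [hF.self]; exact hs))
  refine ⟨u, huY, δ * δ ^ j, hs, ?_, fun y hy => ⟨?_, hcubeF (hballu hy)⟩, fun y hy => ?_⟩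
  · rw [← pow_succ']
    exact hF.pow_anti (by omega)
  · have hyX := hF.subX (hF.cube_subset Q k w (hballu hy))
    have hy' : ρ u y < δ ^ j := lt_of_lt_of_le hy (hF.mul_pow_le j)
    rw [hF.symm] at hux
    calc ρ x y ≤ K * (ρ x u + ρ u y) := hF.tri x hxX y hyX u huX
      _ < K * (4 * K ^ 3 * δ ^ j + δ ^ j) := by
        refine mul_lt_mul_of_pos_left ?_ (by positivity)
        linarith
      _ = (4 * K ^ 4 + K) * δ ^ j := by ring
      _ ≤ 5 * K ^ 4 * δ ^ j := by gcongr
      _ ≤ r := hj.2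
  · obtain ⟨hyx, hyF⟩ := hy
    have hyX := hF.subX (hF.cubesMeeting_subset Q k _ hyF)
    change ρ u y < _
    -- If `j = k`, the ball about `u` has to swallow all of `F`, so the diameter bound is used.
    -- Otherwise minimality bounds `r` by the scale `δ ^ (j - 1)`; this shift and `s = δ ^ (j + 1)`
    -- account for the `δ ^ 2` in the hypothesis on `p`.
    rcases hj.1.eq_or_lt with hkj | hkj
    · have h1 := hF.dist_cubesMeeting_le Q hL hz huF hyF
      have hjpos := hF.pow_pos k
      rw [← hkj]
      calc ρ u y ≤ 2 * K * L * δ ^ k := h1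
        _ < M * δ ^ k := by
          refine mul_lt_mul_of_pos_right ?_ hjpos
          have : 0 < K ^ 5 := by positivity
          linarith
        _ ≤ (2 ^ p * δ ^ 2) * δ ^ k := by gcongr
        _ ≤ (2 ^ p * δ ^ 1) * δ ^ k := by
          gcongr ?_ * _
          exact mul_le_mul_of_nonneg_left (hF.pow_anti one_le_two) (by positivity)
        _ = 2 ^ p * (δ * δ ^ k) := by ring
    · obtain ⟨i, hi⟩ := Nat.exists_eq_add_of_le' (Nat.succ_le_of_lt (Nat.zero_lt_of_lt hkj))
      have hipos := hF.pow_pos i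
      have hri : r < 5 * K ^ 4 * δ ^ i := by
        by_contra hcon
        exact hjmin i (by omega) ⟨by omega, not_lt.1 hcon⟩
      have hyx' : ρ x y ≤ 2 * (5 * K ^ 4 * δ ^ i) := by
        have : ρ x y < 2 * r := hyx
        linarith
      have hux' : ρ u x ≤ 4 * K ^ 4 * δ ^ i := by
        refine hux.trans ?_
        have : δ ^ j ≤ δ ^ i := hF.pow_anti (by omega)
        gcongr
      have hji : δ ^ j = δ ^ i * δ := by rw [hi]; exact pow_succ δ i
      rw [hji]
      calc ρ u y ≤ K * (4 * K ^ 4 * δ ^ i + 2 * (5 * K ^ 4 * δ ^ i)) :=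
            hF.tri_le huX hyX hxX hux' hyx'
        _ = 14 * K ^ 5 * δ ^ i := by ring
        _ < M * δ ^ i := by
          refine mul_lt_mul_of_pos_right ?_ hipos
          have : 0 ≤ 2 * K * L := by positivity
          linarith
        _ ≤ (2 ^ p * δ ^ 2) * δ ^ i := by gcongr
        _ = 2 ^ p * (δ * (δ ^ i * δ)) := by ring

end IsQuasiFrame

/-! ### Homogeneity of a set whose balls are comparable to balls of the space -/

/-- Every ball of `F` contains a ball with centre in `Y` and radius `s ≤ σ`, and the ball of twice
its radius is contained in the ball with the same centre and radius `2 ^ p * s`. -/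
def IsPlump (ρ : Ω → Ω → ℝ) (Y F : Set Ω) (p : ℕ) (σ : ℝ) : Prop :=
  ∀ x ∈ F, ∀ r, 0 < r → ∃ u ∈ Y, ∃ s, 0 < s ∧ s ≤ σ ∧ rhoBall ρ u s ⊆ rhoBall ρ x r ∩ F ∧
    rhoBall ρ x (2 * r) ∩ F ⊆ rhoBall ρ u (2 ^ p * s)

variable [MeasurableSpace Ω] {μ : Measure Ω} {F : Set Ω} {p : ℕ} {σ ε C : ℝ}

theorem IsPlump.doubling (hF : IsPlump ρ Y F p σ) (hd : IsDoublingOn ρ μ Y ε C) (hC : 0 ≤ C)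
    (hσ : 2 ^ p * σ ≤ ε) {x : Ω} (hx : x ∈ F) {r : ℝ} (hr : 0 < r) :
    0 < μ (rhoBall ρ x (2 * r) ∩ F) ∧
    μ (rhoBall ρ x (2 * r) ∩ F) ≤ ENNReal.ofReal (C ^ p) * μ (rhoBall ρ x r ∩ F) ∧
    μ (rhoBall ρ x r ∩ F) < ∞ := by
  obtain ⟨u, huY, s, hs, hsσ, hsub, hsup⟩ := hF x hx r hr
  have h2p : (1 : ℝ) ≤ 2 ^ p := one_le_pow₀ one_le_two
  have hps : 2 ^ p * s ≤ ε := (mul_le_mul_of_nonneg_left hsσ (by positivity)).trans hσ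
  have hsε : s ≤ ε := (le_mul_of_one_le_left hs.le h2p).trans hps
  have hmono : rhoBall ρ x r ∩ F ⊆ rhoBall ρ x (2 * r) ∩ F :=
    inter_subset_inter_left _ (rhoBall_subset_rhoBall (by linarith))
  refine ⟨(hd.pos huY hs hsε).trans_le (measure_mono (hsub.trans hmono)), ?_, ?_⟩
  · calc μ (rhoBall ρ x (2 * r) ∩ F) ≤ μ (rhoBall ρ u (2 ^ p * s)) := measure_mono hsup
      _ ≤ ENNReal.ofReal (C ^ p) * μ (rhoBall ρ u s) := hd.iterate hC huY p hs hps
      _ ≤ ENNReal.ofReal (C ^ p) * μ (rhoBall ρ x r ∩ F) := by gcongr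
  · exact (measure_mono (hmono.trans hsup)).trans_lt (hd u huY _ (by positivity) hps).2.2

/-- The comparison ball has its centre in `Y = D m` and radius at most `2 ^ p * σ`, however large
`r` is. The local modulus therefore controls all balls of `F`. -/
theorem IsPlump.meanOsc_le (hF : IsPlump ρ Y F p σ) (hd : IsDoublingOn ρ μ Y ε C) (hC : 0 ≤ C)
    (hσ : 2 ^ p * σ ≤ ε) {D : ℕ → Set Ω} {m : ℕ} (hY : Y = D m) {f : Ω → ℝ}
    (hf : IntegrableOn f X μ) (hX : ∀ u ∈ Y, ∀ y, ρ u y < ε → y ∈ X) {s₀ : ℝ}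
    (hs₀ : 2 ^ p * σ ≤ s₀) {x : Ω} (hx : x ∈ F) {r : ℝ} (hr : 0 < r) :
    meanOsc μ f (rhoBall ρ x r ∩ F) ≤
      2 * ENNReal.ofReal (C ^ p) * locModulus ρ μ D m f s₀ := by
  obtain ⟨u, huY, s, hs, hsσ, hsub, hsup⟩ := hF x hx r hr
  have h2p : (1 : ℝ) ≤ 2 ^ p := one_le_pow₀ one_le_two
  have hpsσ : 2 ^ p * s ≤ 2 ^ p * σ := mul_le_mul_of_nonneg_left hsσ (by positivity)
  have hps : 2 ^ p * s ≤ ε := hpsσ.trans hσ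
  have hps₀ : 0 < 2 ^ p * s := by positivity
  have hsε : s ≤ ε := (le_mul_of_one_le_left hs.le h2p).trans hps
  have hmono : rhoBall ρ x r ∩ F ⊆ rhoBall ρ x (2 * r) ∩ F :=
    inter_subset_inter_left _ (rhoBall_subset_rhoBall (by linarith))
  have hpos : μ (rhoBall ρ x r ∩ F) ≠ 0 :=
    ((hd.pos huY hs hsε).trans_le (measure_mono hsub)).ne'
  have hballX : rhoBall ρ u (2 ^ p * s) ⊆ X := fun y hy => hX u huY y (lt_of_lt_of_le hy hps)
  refine (meanOsc_le_of_subset (hmono.trans hsup) (hd u huY _ hps₀ hps).2.2.ne hpos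
    (hf.mono_set hballX) (M := ENNReal.ofReal (C ^ p)) ?_).trans ?_
  · exact (hd.iterate hC huY p hs hps).trans (by gcongr)
  · gcongr
    unfold locModulus
    exact le_iSup₂_of_le (2 ^ p * s) ⟨hps₀, hpsσ.trans hs₀⟩ (le_iSup₂_of_le u (hY ▸ huY) le_rfl)

end DyadicSets

/-! ### Dyadic sets in a locally homogeneous space -/

section LocallyHomogeneous

variable {Ω : Type*} [TopologicalSpace Ω] [MeasurableSpace Ω] [BorelSpace Ω] {ρ : Ω → Ω → ℝ}
  {μ : Measure Ω} {D : ℕ → Set Ω} {eps b Cd : ℕ → ℝ}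

namespace IsLocallyHomogeneousSpace

theorem isQuasiFrame (hΩ : IsLocallyHomogeneousSpace ρ μ D eps b Cd) (n : ℕ) {K δ : ℝ}
    (hK : 1 ≤ K) (hbK : b (n + 3) ≤ K) (hδ : 0 < δ) (hδK : 16 * K ^ 3 * δ ≤ 1)
    (hδ₁ : 3 * K ^ 2 * δ ≤ eps (n + 1)) (hδ₂ : δ ≤ eps (n + 2)) :
    IsQuasiFrame ρ (D (n + 1)) (D (n + 2)) (D (n + 3)) K δ where
  nonneg := hΩ.nonneg
  self := fun x => (hΩ.eq_zero_iff x x).2 rfl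
  symm := hΩ.symm
  one_le := hK
  tri := fun x hx y hy z hz => (hΩ.quasi_triangle (n + 3) x hx y hy z hz).trans
    (mul_le_mul_of_nonneg_right hbK (add_nonneg (hΩ.nonneg _ _) (hΩ.nonneg _ _)))
  pos := hδ
  small := hδK
  subY := hΩ.mono (Nat.le_succ _)
  subX := hΩ.mono (Nat.le_succ _)
  near_S := fun x hx y hxy => hΩ.enlarge (n + 1) ⟨x, hx, by
    rw [hΩ.symm]
    linarith [hΩ.eps_pos (n + 1)]⟩
  near_Y := fun x hx y hxy => hΩ.enlarge (n + 2) ⟨x, hx, by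
    rw [hΩ.symm]
    linarith [hΩ.eps_pos (n + 2)]⟩

theorem isDoublingOn (hΩ : IsLocallyHomogeneousSpace ρ μ D eps b Cd) (n : ℕ) :
    IsDoublingOn ρ μ (D n) (eps n) (Cd n) := hΩ.doubling n

theorem exists_rhoBall_subset (hΩ : IsLocallyHomogeneousSpace ρ μ D eps b Cd) (A : Set Ω)
    (hA : IsOpen A) (x : Ω) (hx : x ∈ A) : ∃ r > 0, rhoBall ρ x r ⊆ A :=
  (hΩ.isOpen_iff A).1 hA x hx

theorem measure_lt_top (hΩ : IsLocallyHomogeneousSpace ρ μ D eps b Cd) (n : ℕ) : μ (D n) < ∞ :=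
  have := hΩ.regular
  (measure_mono subset_closure).trans_lt (hΩ.isCompact_closure n).measure_lt_top

theorem rhoBall_subset (hΩ : IsLocallyHomogeneousSpace ρ μ D eps b Cd) {n : ℕ} {x : Ω}
    (hx : x ∈ D n) {r : ℝ} (hr : r ≤ eps n) : rhoBall ρ x r ⊆ D (n + 1) := fun y hy =>
  hΩ.enlarge n ⟨x, hx, by
    have hy' : ρ x y < r := hy
    rw [hΩ.symm]
    linarith [hΩ.eps_pos n]⟩

theorem exists_isDyadicNeighbourhood (hΩ : IsLocallyHomogeneousSpace ρ μ D eps b Cd) {n : ℕ}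
    {K δ : ℝ} (hF : IsQuasiFrame ρ (D (n + 1)) (D (n + 2)) (D (n + 3)) K δ) {x : Ω} (hx : x ∈ D n)
    {R : ℝ} (hR : 0 < R) (hRδ : R ≤ δ) : ∃ F, IsDyadicNeighbourhood ρ D b n δ x R F := by
  obtain ⟨Q⟩ := hF.nonempty_dyadicSystem (hΩ.one_le_B (n + 2)) (hΩ.quasi_triangle (n + 2))
  obtain ⟨k, hk1, hk2⟩ := exists_nat_pow_near_of_lt_one hR (hRδ.trans hF.lt_one.le) hF.pos hF.lt_one
  refine ⟨_, Q, k, x, ?_, hk1, hk2, hΩ.mono (Nat.le_succ n) hx, ?_, rfl⟩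
  · by_contra hk
    obtain rfl : k = 0 := by omega
    simp at hk1
    linarith
  · rw [hF.self]
    have := zero_lt_one.trans_le (hΩ.one_le_B (n + 1))
    have := hF.pow_pos k
    positivity

end IsLocallyHomogeneousSpace

/-- The constants that control the dyadic sets of parameter `δ` for `Ω_n`. -/
structure IsAdmissible (eps b Cd : ℕ → ℝ) (n : ℕ) (K δ L : ℝ) (p : ℕ) (c : ℝ) : Prop where
  le_K : b (n + 2) ≤ K
  L_eq : L = K * (b (n + 1) * (1 + 7 * b (n + 1) ^ 4) + 6 * K ^ 3)
  le_two_pow : 2 * K * L + 14 * K ^ 5 + K * (7 * b (n + 1) ^ 4 + L) + 1 ≤ 2 ^ p * δ ^ 2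
  K_le : K ≤ c
  two_pow_le : 2 ^ p ≤ c
  C_pow_le : 2 * Cd (n + 2) ^ p ≤ c

/-! ### The properties of `F` in terms of the admissible constants -/

section Properties

variable {n : ℕ} {K δ L c R : ℝ} {p : ℕ} {x : Ω} {F : Set Ω}

theorem IsDyadicNeighbourhood.measure_properties
    (hΩ : IsLocallyHomogeneousSpace ρ μ D eps b Cd)
    (hF : IsQuasiFrame ρ (D (n + 1)) (D (n + 2)) (D (n + 3)) K δ)
    (hc : IsAdmissible eps b Cd n K δ L p c) (hx : x ∈ D n) (hR : 0 < R) (hRn : R ≤ eps n)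
    (hcR : c * R ≤ eps (n + 2)) (hFx : IsDyadicNeighbourhood ρ D b n δ x R F) :
    (IsOpen F ∧ (∃ E, μ E = 0 ∧ rhoBall ρ x R \ E ⊆ F) ∧ F ⊆ D (n + 2) ∧
      rhoBall ρ x R ⊆ closure F ∧ (∀ y ∈ F, ∀ z ∈ F, ρ y z ≤ c * R) ∧
      μ F ≤ ENNReal.ofReal c * μ (rhoBall ρ x R)) ∧ IsPlump ρ (D (n + 2)) F p R := by
  obtain ⟨Q, k, z, hk, hkR, hRk, hz, hxz, rfl⟩ := hFx
  have hK := hF.one_le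
  have hδ := hF.pos
  have hb1 := hΩ.one_le_B (n + 1)
  have hb2 : 0 < b (n + 2) := zero_lt_one.trans_le (hΩ.one_le_B (n + 2))
  have hb1pos : 0 < b (n + 1) := zero_lt_one.trans_le hb1
  have hL₀ : 0 ≤ L := by rw [hc.L_eq]; positivity
  have hKc : 0 < c := by linarith [hc.K_le]
  have hkpos := hF.pow_pos k
  have hC : 0 ≤ Cd (n + 2) := zero_le_one.trans (hΩ.one_lt_C (n + 2)).le
  set h := b (n + 1) * (1 + 7 * b (n + 1) ^ 4) with hh
  have hxS : x ∈ D (n + 1) := hΩ.mono (Nat.le_succ n) hx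
  have hxY : x ∈ D (n + 2) := hF.subY hxS
  -- Converts bounds at scale `δ ^ k` into bounds by `R`, as `δ ^ (k + 2) ≤ δ ^ (k + 1) < R`.
  have hpk : 2 ^ p * δ ^ 2 * δ ^ k ≤ 2 ^ p * R := by
    rw [mul_assoc]
    gcongr
    rw [← pow_add]
    exact (hF.pow_anti (by omega)).trans hkR.le
  have hpR : 2 ^ p * R ≤ c * R := mul_le_mul_of_nonneg_right hc.two_pow_le hR.le
  have hpos1 : 0 ≤ K * (7 * b (n + 1) ^ 4 + L) := by positivity
  have hpos2 : 0 ≤ 2 * K * L := by positivity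
  have hpos3 : 0 ≤ K ^ 5 := by positivity
  have hFopen : IsOpen (Q.cubesMeeting k (rhoBall ρ z (h * δ ^ k))) :=
    isOpen_iUnion fun w => isOpen_iUnion fun _ => isOpen_iUnion fun _ =>
      hF.isOpen_cube hΩ.isOpen_ball Q k w
  have hballS : rhoBall ρ x R ⊆ D (n + 1) := hΩ.rhoBall_subset hx hRn
  have hballz : rhoBall ρ x R ⊆ rhoBall ρ z (h * δ ^ k) := by
    intro y hy
    have hy' : ρ x y < R := hy
    rw [hF.symm] at hxz
    calc ρ z y ≤ b (n + 1) * (ρ z x + ρ x y) :=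
          hΩ.quasi_triangle (n + 1) z hz y (hballS hy) x hxS
      _ < b (n + 1) * (7 * b (n + 1) ^ 4 * δ ^ k + δ ^ k) := by
        refine mul_lt_mul_of_pos_left ?_ hb1pos
        linarith
      _ = h * δ ^ k := by rw [hh]; ring
  have hmem : ∀ y, y ∈ rhoBall ρ z (h * δ ^ k) → ∀ u ∈ Q.net k, y ∈ Q.cube k u →
      y ∈ Q.cubesMeeting k (rhoBall ρ z (h * δ ^ k)) := fun y hy u hu hyu =>
    DyadicSystem.mem_cubesMeeting.2 ⟨u, hu, ⟨y, hyu, hy⟩, hyu⟩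
  refine ⟨⟨hFopen, ?_, hF.cubesMeeting_subset Q k _, ?_, ?_, ?_⟩, ?_⟩
  · have := hΩ.regular
    refine ⟨_, hF.measure_diff_eq_zero Q hΩ.exists_rhoBall_subset hΩ.isOpen_ball
      (hΩ.isDoublingOn (n + 2)) (hΩ.eps_pos _) hC (hΩ.measure_lt_top _) (hΩ.measurableSet _) hk, ?_⟩
    rintro y ⟨hy, hyE⟩
    have hyU : y ∈ Q.allCubes k := by
      by_contra hcon
      exact hyE ⟨hballS hy, hcon⟩
    obtain ⟨u, hu, hyu⟩ := mem_iUnion₂.1 hyU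
    exact hmem y (hballz hy) u hu hyu
  · intro y hy
    refine mem_closure_iff.2 fun V hV hyV => ?_
    obtain ⟨u, hu, q, ⟨hqV, hqx⟩, hqu⟩ := hF.exists_mem_cube_of_isOpen Q hΩ.exists_rhoBall_subset hk
      (hF.exists_net_near_of_mem Q.isNetSequence hk (hballS hy))
      (hV.inter (hΩ.isOpen_ball x R hR)) ⟨hyV, hy⟩
    exact ⟨q, hqV, hmem q (hballz hqx) u hu hqu⟩
  · intro y hy y' hy'
    refine (hF.dist_cubesMeeting_le Q hc.L_eq hz hy hy').trans (le_trans ?_ (hpk.trans hpR))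
    refine mul_le_mul_of_nonneg_right ?_ hkpos.le
    linarith [hc.le_two_pow]
  · have hsub : Q.cubesMeeting k (rhoBall ρ z (h * δ ^ k)) ⊆ rhoBall ρ x (2 ^ p * R) := by
      intro y hy
      have h1 := hF.dist_centre_le Q hz hy
      rw [← hc.L_eq] at h1
      change ρ x y < _
      calc ρ x y ≤ K * (7 * b (n + 1) ^ 4 * δ ^ k + L * δ ^ k) :=
            hF.tri_le (hF.subX hxY) (hF.subX (hF.cubesMeeting_subset Q k _ hy))
              (hF.subX (hF.subY hz)) hxz.le h1
        _ = K * (7 * b (n + 1) ^ 4 + L) * δ ^ k := by ring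
        _ < 2 ^ p * δ ^ 2 * δ ^ k := by
          refine mul_lt_mul_of_pos_right ?_ hkpos
          linarith [hc.le_two_pow]
        _ ≤ 2 ^ p * R := hpk
    refine (measure_mono hsub).trans
      (((hΩ.isDoublingOn (n + 2)).iterate hC hxY p hR (hpR.trans hcR)).trans ?_)
    gcongr
    linarith [hc.C_pow_le, pow_nonneg hC p]
  · intro y hy r hr
    obtain ⟨u, hu, s, hs, hsk, hsub⟩ := hF.exists_balls hb2 hc.le_K Q hΩ.exists_rhoBall_subset
      hΩ.isOpen_ball hc.L_eq hL₀ (M := 2 ^ p * δ ^ 2) (by linarith [hc.le_two_pow]) le_rfl hz hy hr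
    exact ⟨u, hu, s, hs, hsk.trans hkR.le, hsub⟩

theorem IsPlump.isHomogeneousTypeOn (hΩ : IsLocallyHomogeneousSpace ρ μ D eps b Cd)
    (hK : 1 ≤ K) (hc : IsAdmissible eps b Cd n K δ L p c) (hR : 0 < R)
    (hcR : c * R ≤ eps (n + 2)) (hF : IsPlump ρ (D (n + 2)) F p R) (hFopen : IsOpen F)
    (hFY : F ⊆ D (n + 2)) : IsHomogeneousTypeOn ρ μ F c c where
  measurableSet := hFopen.measurableSet
  nonneg := fun x _ y _ => hΩ.nonneg x y
  eq_zero_iff := fun x _ y _ => hΩ.eq_zero_iff x y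
  symm := fun x _ y _ => hΩ.symm x y
  one_le := hK.trans hc.K_le
  quasi_triangle := fun x hx y hy z hz =>
    (hΩ.quasi_triangle (n + 2) x (hFY hx) y (hFY hy) z (hFY hz)).trans
      (mul_le_mul_of_nonneg_right (hc.le_K.trans hc.K_le)
        (add_nonneg (hΩ.nonneg _ _) (hΩ.nonneg _ _)))
  isOpen_ball := fun x _ r hr y hy => by
    obtain ⟨s, hs, hsub⟩ := hΩ.exists_rhoBall_subset _ (hΩ.isOpen_ball x r hr) y hy.1
    exact ⟨s, hs, inter_subset_inter_left _ hsub⟩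
  doubling := fun x hx r hr => by
    have hC : 0 ≤ Cd (n + 2) := zero_le_one.trans (hΩ.one_lt_C (n + 2)).le
    have h := hF.doubling (hΩ.isDoublingOn (n + 2)) hC
      ((mul_le_mul_of_nonneg_right hc.two_pow_le hR.le).trans hcR) hx hr
    refine ⟨h.1, h.2.1.trans ?_, h.2.2⟩
    gcongr
    linarith [hc.C_pow_le, pow_nonneg hC p]

theorem IsPlump.bmoNormOn_le (hΩ : IsLocallyHomogeneousSpace ρ μ D eps b Cd)
    (hc : IsAdmissible eps b Cd n K δ L p c) (hR : 0 < R) (hcR : c * R ≤ eps (n + 2))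
    (hF : IsPlump ρ (D (n + 2)) F p R) {f : Ω → ℝ} (hf : IntegrableOn f (D (n + 3)) μ) :
    bmoNormOn ρ μ F f ≤ ENNReal.ofReal c * locModulus ρ μ D (n + 2) f (c * R) := by
  have hC : 0 ≤ Cd (n + 2) := zero_le_one.trans (hΩ.one_lt_C (n + 2)).le
  have hpR : 2 ^ p * R ≤ c * R := mul_le_mul_of_nonneg_right hc.two_pow_le hR.le
  refine iSup₂_le fun _ _ => iSup₂_le fun t ht => iSup₂_le fun x hx => ?_
  refine (hF.meanOsc_le (hΩ.isDoublingOn (n + 2)) hC (hpR.trans hcR) rfl hf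
    (fun u hu y hy => hΩ.rhoBall_subset hu le_rfl hy) hpR hx ht.1).trans ?_
  gcongr
  rw [← ENNReal.ofReal_ofNat, ← ENNReal.ofReal_mul zero_le_two]
  exact ENNReal.ofReal_le_ofReal hc.C_pow_le

end Properties

end LocallyHomogeneous

/-- `ε i, B i, C i` are the constants of `Ω_{n+i}`, `i = 0, 1, 2, 3`. -/
theorem mainTheorem10 (ε B C : Fin 4 → ℝ) :
    ∃ δ₀ > (0 : ℝ), ∀ δ : ℝ, 0 < δ → δ ≤ δ₀ →
    ∃ c > (0 : ℝ), ∃ R₀ > (0 : ℝ),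
    ∀ (Ω : Type*) [TopologicalSpace Ω] [MeasurableSpace Ω] [BorelSpace Ω]
      (ρ : Ω → Ω → ℝ) (μ : Measure Ω) (D : ℕ → Set Ω) (eps b Cd : ℕ → ℝ),
    IsLocallyHomogeneousSpace ρ μ D eps b Cd →
    ∀ n : ℕ, (∀ i : Fin 4, eps (n + i) = ε i ∧ b (n + i) = B i ∧ Cd (n + i) = C i) →
    c * R₀ ≤ eps (n + 2) ∧
    (∀ x ∈ D n, ∀ R : ℝ, 0 < R → R ≤ R₀ →
      (∃ F, IsDyadicNeighbourhood ρ D b n δ x R F) ∧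
      ∀ F, IsDyadicNeighbourhood ρ D b n δ x R F →
        (IsOpen F ∧
          IsHomogeneousTypeOn ρ μ F c c ∧
          (∃ E, μ E = 0 ∧ rhoBall ρ x R \ E ⊆ F) ∧ F ⊆ D (n + 2) ∧
          rhoBall ρ x R ⊆ closure F ∧
          (∀ y ∈ F, ∀ z ∈ F, ρ y z ≤ c * R) ∧
          μ F ≤ ENNReal.ofReal c * μ (rhoBall ρ x R)) ∧
        ∀ f : Ω → ℝ, MemBMOloc ρ μ D eps (n + 2) f →
          MemBMOOn ρ μ F f ∧
          bmoNormOn ρ μ F f ≤ ENNReal.ofReal c * locModulus ρ μ D (n + 2) f (c * R) ∧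
          ENNReal.ofReal c * locModulus ρ μ D (n + 2) f (c * R) ≤
            ENNReal.ofReal c * bmoLocNorm ρ μ D eps (n + 2) f) ∧
    (∀ f : Ω → ℝ, MemVMOloc ρ μ D eps (n + 2) f →
      ∀ τ : ℝ≥0∞, 0 < τ → ∃ r₀ > (0 : ℝ), r₀ ≤ R₀ ∧
        ∀ x ∈ D n, ∀ R : ℝ, 0 < R → R ≤ r₀ →
          ∀ F, IsDyadicNeighbourhood ρ D b n δ x R F → bmoNormOn ρ μ F f < τ) := by
  -- For other values of the constants no such space exists, and the claim is vacuous.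
  by_cases hv : ∀ i, 0 < ε i ∧ 1 ≤ B i ∧ 1 < C i
  swap
  · refine ⟨1, one_pos, fun δ _ _ => ⟨1, one_pos, 1, one_pos, ?_⟩⟩
    intro Ω _ _ _ ρ μ D eps b Cd hΩ n hn
    refine absurd (fun i => ?_) hv
    obtain ⟨h1, h2, h3⟩ := hn i
    rw [← h1, ← h2, ← h3]
    exact ⟨hΩ.eps_pos _, hΩ.one_le_B _, hΩ.one_lt_C _⟩
  -- The constants need not be monotone: `B 3` serves the quasitriangle inequality on `Ω_{n+3}`, and
  -- `B 2` is the constant in (T4).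
  set K := max (B 2) (B 3) with hK_def
  have hK : 1 ≤ K := (hv 2).2.1.trans (le_max_left _ _)
  have hK₀ : 0 < K := zero_lt_one.trans_le hK
  refine ⟨min (1 / (16 * K ^ 3)) (min (ε 1 / (3 * K ^ 2)) (ε 2)), ?_, fun δ hδ hδ₀ => ?_⟩
  · have h1 := (hv 1).1
    have h2 := (hv 2).1
    positivity
  obtain ⟨hδK, hδ₁, hδ₂⟩ : 16 * K ^ 3 * δ ≤ 1 ∧ 3 * K ^ 2 * δ ≤ ε 1 ∧ δ ≤ ε 2 := by
    refine ⟨?_, ?_, hδ₀.trans ((min_le_right _ _).trans (min_le_right _ _))⟩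
    · have := hδ₀.trans (min_le_left _ _)
      rw [le_div_iff₀ (by positivity)] at this
      linarith
    · have := hδ₀.trans ((min_le_right _ _).trans (min_le_left _ _))
      rw [le_div_iff₀ (by positivity)] at this
      linarith
  set L := K * (B 1 * (1 + 7 * B 1 ^ 4) + 6 * K ^ 3) with hL
  obtain ⟨p, hp⟩ := pow_unbounded_of_one_lt
    ((2 * K * L + 14 * K ^ 5 + K * (7 * B 1 ^ 4 + L) + 1) / δ ^ 2) one_lt_two
  rw [div_lt_iff₀ (by positivity)] at hp
  set c : ℝ := K + 2 ^ p + 2 * C 2 ^ p with hc_def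
  have hC₀ : 0 < C 2 := zero_lt_one.trans (hv 2).2.2
  have hCp : 0 < C 2 ^ p := by positivity
  have h2p : (0 : ℝ) < 2 ^ p := by positivity
  have hc₀ : 0 < c := by linarith
  -- The three bounds on `R` ensure, in turn, that doubling holds up to radius `c * R`, that the
  -- generation `k` is at least 1, and that `B(x, R) ⊆ Ω_{n+1}`.
  refine ⟨c, hc₀, min (ε 2 / c) (min δ (ε 0)), ?_, ?_⟩
  · have h0 := (hv 0).1
    have h2 := (hv 2).1
    positivity
  intro Ω _ _ _ ρ μ D eps b Cd hΩ n hn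
  have e0 : eps n = ε 0 := (hn 0).1
  obtain ⟨e1, b1, -⟩ : eps (n + 1) = ε 1 ∧ b (n + 1) = B 1 ∧ Cd (n + 1) = C 1 := hn 1
  obtain ⟨e2, b2, c2⟩ : eps (n + 2) = ε 2 ∧ b (n + 2) = B 2 ∧ Cd (n + 2) = C 2 := hn 2
  have b3 : b (n + 3) = B 3 := (hn 3).2.1
  have hF := hΩ.isQuasiFrame n hK (b3 ▸ le_max_right _ _) hδ hδK (e1 ▸ hδ₁) (e2 ▸ hδ₂)
  have hadm : IsAdmissible eps b Cd n K δ L p c :=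
    { le_K := b2 ▸ le_max_left _ _
      L_eq := by rw [b1]
      le_two_pow := by rw [b1]; exact hp.le
      K_le := by linarith
      two_pow_le := by linarith
      C_pow_le := by rw [c2]; linarith }
  have hscale : ∀ R, R ≤ min (ε 2 / c) (min δ (ε 0)) →
      c * R ≤ eps (n + 2) ∧ R ≤ δ ∧ R ≤ eps n := by
    intro R hR
    refine ⟨?_, hR.trans ((min_le_right _ _).trans (min_le_left _ _)),
      e0 ▸ hR.trans ((min_le_right _ _).trans (min_le_right _ _))⟩
    have := hR.trans (min_le_left _ _)
    rw [le_div_iff₀ hc₀] at this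
    rw [e2]
    linarith
  have hbmo : ∀ x ∈ D n, ∀ R : ℝ, 0 < R → R ≤ min (ε 2 / c) (min δ (ε 0)) →
      ∀ F, IsDyadicNeighbourhood ρ D b n δ x R F → ∀ f, MemBMOloc ρ μ D eps (n + 2) f →
      bmoNormOn ρ μ F f ≤ ENNReal.ofReal c * locModulus ρ μ D (n + 2) f (c * R) := by
    intro x hx R hR hRR F hFx f hf
    obtain ⟨hcR, hRδ, hRn⟩ := hscale R hRR
    exact (hFx.measure_properties hΩ hF hadm hx hR hRn hcR).2.bmoNormOn_le hΩ hadm hR hcR hf.1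
  refine ⟨(hscale _ le_rfl).1, fun x hx R hR hRR => ?_, fun f hf τ hτ => ?_⟩
  · obtain ⟨hcR, hRδ, hRn⟩ := hscale R hRR
    refine ⟨hΩ.exists_isDyadicNeighbourhood hF hx hR hRδ, fun F hFx => ?_⟩
    obtain ⟨⟨h1, h2, h3, h4⟩, hplump⟩ := hFx.measure_properties hΩ hF hadm hx hR hRn hcR
    refine ⟨⟨h1, hplump.isHomogeneousTypeOn hΩ hK hadm hR hcR h1 h3, h2, h3, h4⟩, fun f hf => ?_⟩
    have hle := hbmo x hx R hR hRR F hFx f hf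
    have hle' : ENNReal.ofReal c * locModulus ρ μ D (n + 2) f (c * R) ≤
        ENNReal.ofReal c * bmoLocNorm ρ μ D eps (n + 2) f := by
      gcongr
      unfold bmoLocNorm
      exact le_iSup₂_of_le (c * R) ⟨by positivity, hcR⟩ le_rfl
    exact ⟨⟨hf.1.mono_set (h3.trans (hΩ.mono (Nat.le_succ _))),
      (hle.trans hle').trans_lt (ENNReal.mul_lt_top ENNReal.ofReal_lt_top hf.2)⟩, hle, hle'⟩
  · have hlim : Tendsto (fun s => ENNReal.ofReal c * locModulus ρ μ D (n + 2) f s) (𝓝[>] 0)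
        (𝓝 0) := by
      simpa using ENNReal.Tendsto.const_mul hf.2 (Or.inr ENNReal.ofReal_ne_top)
    obtain ⟨s, hs, hsτ⟩ := mem_nhdsGT_iff_exists_Ioc_subset.1 (hlim.eventually_lt_const hτ)
    have hs₀ : 0 < s := hs
    refine ⟨min (min (ε 2 / c) (min δ (ε 0))) (s / c), ?_, min_le_left _ _, ?_⟩
    · have h0 := (hv 0).1
      have h2 := (hv 2).1
      positivity
    · intro x hx R hR hRr F hFx
      refine (hbmo x hx R hR (hRr.trans (min_le_left _ _)) F hFx f hf.1).trans_lt
        (hsτ ⟨by positivity, ?_⟩)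
      have := hRr.trans (min_le_right _ _)
      rw [le_div_iff₀ hc₀] at this
      linarith
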